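/- Let $d\ge 2$ and let $W_i\in\mathbb{R}^{n_i\times n_{i-1}}$, $i=1,\dots,d$, with $n_0=k$. Let $G:\mathbb{R}^k\to\mathbb{R}^{n_d}$ be the network $$G(x)=\operatorname{relu}\bigl(W_d\cdots\operatorname{relu}(W_2\operatorname{relu}(W_1x))\cdots\bigr),\qquad \operatorname{relu}(t)=\max(t,0)\ \text{entrywise},$$ let $A\in\mathbb{R}^{m\times n_d}$, and for $x_0\in\mathbb{R}^k$ put $f(x)=\tfrac12\bigl\||AG(x)|-|AG(x_0)|\bigr\|^2$, with $|\cdot|$ acting entrywise. Let $D_vf(x)=\lim_{t\to0^+}\frac{f(x+tv)-f(x)}{t}$ denote the one-sided directional derivative. Norms are Euclidean for vectors and spectral for matrices, and $\mathcal{B}(x,r)$ is the Euclidean ball. For non-zero $x,y\in\mathbb{R}^n$ let $\hat x=x/\|x\|$, let $\theta_{x,y}=\angle(x,y)$, and let $M_{\hat x\leftrightarrow\hat y}$ be the matrix that sends $\hat x\mapsto\hat y$, $\hat y\mapsto\hat x$, and $z\mapsto0$ for all $z\in\operatorname{span}(\{x,y\})^\perp$. * A matrix $W\in\mathbb{R}^{n\times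 k}$ satisfies the *Weight Distribution Condition* (WDC) with constant $\epsilon$ if for all non-zero $x,y\in\mathbb{R}^k$ $$\Bigl\|W_{+,x}^\top W_{+,y}-\tfrac{\pi-\theta_{x,y}}{2\pi}I_k-\tfrac{\sin\theta_{x,y}}{2\pi}M_{\hat x\leftrightarrow\hat y}\Bigr\|\le\epsilon,\qquad W_{+,x}=\operatorname{diag}(Wx>0)\,W .$$ * $A$ satisfies the *Range Restricted Concentration Property* (RRCP) with constant $\epsilon$ if for all non-zero $x,y\in\mathbb{R}^k$ and all $x_1,x_2,x_3,x_4\in\mathbb{R}^k$ $$\bigl|\bigl\langle (A_{G(x)}^\top A_{G(y)}-\Phi_{G(x),G(y)})(G(x_1)-G(x_2)),\,G(x_3)-G(x_4)\bigr\rangle\bigr|\le 7\epsilon\,\|G(x_1)-G(x_2)\|\,\|G(x_3)-G(x_4)\|,$$ where $A_z=\operatorname{diag}(\operatorname{sgn}(Az))A$ (with $\operatorname{sgn}0=0$) and $\Phi_{z,w}=\frac{\pi-2\theta_{z,w}}{\pi}I_{n_d}+\frac{2\sin\theta_{z,w}}{\pi}M_{\hat z\leftrightarrow\hat w}$. Let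 $g(\theta)=\cos^{-1}\bigl(\frac{(\pi-\theta)\cos\theta+\sin\theta}{\pi}\bigr)$, $\breve\theta_0=\pi$, $\breve\theta_i=g(\breve\theta_{i-1})$, and $$\rho_d=\frac{2\sin\breve\theta_d}{\pi}+\frac{\pi-2\breve\theta_d}{\pi}\sum_{i=0}^{d-1}\frac{\sin\breve\theta_i}{\pi}\prod_{j=i+1}^{d-1}\frac{\pi-\breve\theta_j}{\pi}.$$ **Theorem.** One has $\rho_d>0$ for all $d\ge2$ and $\rho_d\to1$ as $d\to\infty$, and there are universal constants $K_1,K_2>0$ such that the following holds. Let $d\ge2$ and let $\epsilon>0$ satisfy $K_1d^8\epsilon^{1/4}\le1$. Suppose that $W_i$ satisfies the WDC with constant $\epsilon$ for every $i=1,\dots,d$ and that $A$ satisfies the RRCP with constant $\epsilon$. Then for all non-zero $x,x_0\in\mathbb{R}^k$ there exists $v_{x,x_0}\in\mathbb{R}^k$ such that the one-sided directional derivatives of $f$ below exist and satisfy $$D_{-v_{x,x_0}}f(x)<0\quad\text{for all } x\notin\mathcal{B}(x_0,K_2d^3\epsilon^{1/4}\|x_0\|)\cup\mathcal{B}(-\rho_dx_0,K_2d^{14}\epsilon^{1/4}\|x_0\|)\cup\{0\},$$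 $$D_xf(0)<0\quad\text{for all } x\ne0.$$ -/

import Mathlib

noncomputable section

namespace DeepPR

/-- `ℝⁿ` with the Euclidean norm. -/
abbrev E (n : ℕ) : Type := EuclideanSpace ℝ (Fin n)

/-- The normalization `x̂ = x / ‖x‖` (used for non-zero `x`). -/
def hat {n : ℕ} (x : E n) : E n := ‖x‖⁻¹ • x

/-- The operator `M_{x̂ ↔ ŷ}`: the orthogonal projection onto `span {x, y}` followed by the
reflection that exchanges `x̂` and `ŷ`. For non-zero `x`, `y` it is the unique linear map that sends
`x̂ ↦ ŷ`, `ŷ ↦ x̂` and `z ↦ 0` for `z ⊥ span {x, y}`; see `swapMap_hat_left`, `swapMap_hat_right`,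
`swapMap_orthogonal` and `swapMap_unique`. -/
def swapMap {n : ℕ} (x y : E n) : E n →L[ℝ] E n :=
  ((Submodule.span ℝ {hat x - hat y})ᗮ.reflection : E n →L[ℝ] E n) ∘L
    (Submodule.span ℝ {x, y}).starProjection

theorem norm_hat {n : ℕ} {x : E n} (hx : x ≠ 0) : ‖hat x‖ = 1 := by
  have h : ‖x‖ ≠ 0 := norm_ne_zero_iff.mpr hx
  simp [hat, norm_smul, h]

theorem swapMap_hat_left {n : ℕ} {x y : E n} (hx : x ≠ 0) (hy : y ≠ 0) :
    swapMap x y (hat x) = hat y := by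
  have hm : hat x ∈ Submodule.span ℝ {x, y} :=
    Submodule.smul_mem _ _ (Submodule.subset_span (by simp))
  have h : (Submodule.span ℝ {hat x - hat y})ᗮ.reflection (hat x) = hat y :=
    Submodule.reflection_sub ((norm_hat hx).trans (norm_hat hy).symm)
  simpa [swapMap, Submodule.starProjection_eq_self_iff.mpr hm] using h

theorem swapMap_hat_right {n : ℕ} {x y : E n} (hx : x ≠ 0) (hy : y ≠ 0) :
    swapMap x y (hat y) = hat x := by
  have hm : hat y ∈ Submodule.span ℝ {x, y} :=
    Submodule.smul_mem _ _ (Submodule.subset_span (by simp))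
  have h : (Submodule.span ℝ {hat x - hat y})ᗮ.reflection (hat x) = hat y :=
    Submodule.reflection_sub ((norm_hat hx).trans (norm_hat hy).symm)
  have h' : (Submodule.span ℝ {hat x - hat y})ᗮ.reflection (hat y) = hat x := by
    have h2 := Submodule.reflection_reflection (Submodule.span ℝ {hat x - hat y})ᗮ (hat x)
    rwa [h] at h2
  simpa [swapMap, Submodule.starProjection_eq_self_iff.mpr hm] using h'

theorem swapMap_orthogonal {n : ℕ} {x y z : E n} (hz : z ∈ (Submodule.span ℝ {x, y})ᗮ) :
    swapMap x y z = 0 := by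
  have h : (Submodule.span ℝ {x, y}).starProjection z = 0 :=
    (Submodule.starProjection_apply_eq_zero_iff _).mpr hz
  simp [swapMap, h]

theorem swapMap_unique {n : ℕ} {x y : E n} (hx : x ≠ 0) (hy : y ≠ 0) (M : E n →L[ℝ] E n)
    (h₁ : M (hat x) = hat y) (h₂ : M (hat y) = hat x)
    (h₃ : ∀ z ∈ (Submodule.span ℝ {x, y})ᗮ, M z = 0) : M = swapMap x y := by
  have e : ∀ {u : E n}, u ≠ 0 → u = ‖u‖ • hat u := fun {u} hu => by
    simp [hat, smul_smul, norm_ne_zero_iff.mpr hu]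
  have key : ∀ u ∈ Submodule.span ℝ {x, y}, M u = swapMap x y u := by
    intro u hu
    obtain ⟨a, b, rfl⟩ := Submodule.mem_span_pair.mp hu
    rw [e hx, e hy]
    simp only [map_add, map_smul]
    have s1 := swapMap_hat_left hx hy
    have s2 := swapMap_hat_right hx hy
    rw [← e hx, ← e hy, h₁, h₂, s1, s2]
  ext1 u
  have hu : u = (Submodule.span ℝ {x, y}).starProjection u +
      (u - (Submodule.span ℝ {x, y}).starProjection u) := by abel
  have ho : u - (Submodule.span ℝ {x, y}).starProjection u ∈ (Submodule.span ℝ {x, y})ᗮ :=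
    Submodule.sub_starProjection_mem_orthogonal u
  rw [hu, map_add, map_add, h₃ _ ho, swapMap_orthogonal ho,
    key _ (Submodule.starProjection_apply_mem _ u)]

/-- `W_{+,x} = diag(W x > 0) W`. -/
def posRows {n k : ℕ} (W : Matrix (Fin n) (Fin k) ℝ) (x : E k) : Matrix (Fin n) (Fin k) ℝ :=
  Matrix.diagonal (fun i => if 0 < Matrix.toEuclideanLin W x i then (1 : ℝ) else 0) * W

/-- `A_z = diag(sgn(A z)) A`, where `sgn 0 = 0`. -/
def signRows {m n : ℕ} (A : Matrix (Fin m) (Fin n) ℝ) (z : E n) : Matrix (Fin m) (Fin n) ℝ :=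
  Matrix.diagonal (fun i => Real.sign (Matrix.toEuclideanLin A z i)) * A

/-- `Q_{x,y} = ((π - θ) / (2π)) I + (sin θ / (2π)) M_{x̂ ↔ ŷ}` with `θ = ∠(x, y)`. -/
def Q {k : ℕ} (x y : E k) : E k →L[ℝ] E k :=
  ((Real.pi - InnerProductGeometry.angle x y) / (2 * Real.pi)) • ContinuousLinearMap.id ℝ (E k) +
    (Real.sin (InnerProductGeometry.angle x y) / (2 * Real.pi)) • swapMap x y

/-- `Φ_{z,w} = ((π - 2θ) / π) I + (2 sin θ / π) M_{ẑ ↔ ŵ}` with `θ = ∠(z, w)`. -/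
def Phi {n : ℕ} (z w : E n) : E n →L[ℝ] E n :=
  ((Real.pi - 2 * InnerProductGeometry.angle z w) / Real.pi) • ContinuousLinearMap.id ℝ (E n) +
    (2 * Real.sin (InnerProductGeometry.angle z w) / Real.pi) • swapMap z w

/-- The Weight Distribution Condition with constant `ε` (in spectral norm). -/
def WDC {n k : ℕ} (W : Matrix (Fin n) (Fin k) ℝ) (ε : ℝ) : Prop :=
  ∀ x y : E k, x ≠ 0 → y ≠ 0 →
    ‖Matrix.toEuclideanCLM (𝕜 := ℝ) ((posRows W x).transpose * posRows W y) - Q x y‖ ≤ ε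

/-- The Range Restricted Concentration Property of `A` with constant `ε`, relative to the
generative model `G`. -/
def RRCP {k n m : ℕ} (G : E k → E n) (A : Matrix (Fin m) (Fin n) ℝ) (ε : ℝ) : Prop :=
  ∀ x y : E k, x ≠ 0 → y ≠ 0 → ∀ x₁ x₂ x₃ x₄ : E k,
    |inner ℝ
        ((Matrix.toEuclideanCLM (𝕜 := ℝ)
            ((signRows A (G x)).transpose * signRows A (G y)) - Phi (G x) (G y))
          (G x₁ - G x₂))
        (G x₃ - G x₄)| ≤ 7 * ε * ‖G x₁ - G x₂‖ * ‖G x₃ - G x₄‖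

/-- The entrywise `relu`. -/
def relu {n : ℕ} (z : E n) : E n := WithLp.toLp 2 fun i => max (z i) 0

/-- The entrywise absolute value. -/
def absVec {n : ℕ} (z : E n) : E n := WithLp.toLp 2 fun i => |z i|

/-- The depth-`d` network `relu (W_d ⋯ relu (W_2 (relu (W_1 x))) ⋯)`. The layer `W_{i+1}`, of size
`n_{i+1} × n_i`, is the matrix `W i`; only `W 0, …, W (d - 1)` enter. -/
def gen {n : ℕ → ℕ} (W : ∀ i, Matrix (Fin (n (i + 1))) (Fin (n i)) ℝ) :
    ∀ d : ℕ, E (n 0) → E (n d)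
  | 0, x => x
  | d + 1, x => relu (Matrix.toEuclideanLin (W d) (gen W d x))

/-- The empirical risk `f(x) = ½ ‖ |A G(x)| - |A G(x₀)| ‖²`. -/
def risk {k n m : ℕ} (G : E k → E n) (A : Matrix (Fin m) (Fin n) ℝ) (x₀ x : E k) : ℝ :=
  1 / 2 * ‖absVec (Matrix.toEuclideanLin A (G x)) - absVec (Matrix.toEuclideanLin A (G x₀))‖ ^ 2

/-- The one-sided directional derivative `D_v f(x)` exists and equals `D`. -/
def HasOneSidedDeriv {k : ℕ} (f : E k → ℝ) (x v : E k) (D : ℝ) : Prop :=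
  Filter.Tendsto (fun t : ℝ => (f (x + t • v) - f x) / t) (nhdsWithin 0 (Set.Ioi 0)) (nhds D)

/-- `g(θ) = arccos ((cos θ (π - θ) + sin θ) / π)`. -/
def g (θ : ℝ) : ℝ :=
  Real.arccos ((Real.cos θ * (Real.pi - θ) + Real.sin θ) / Real.pi)

/-- The angles `θ̆₀ = π`, `θ̆ᵢ₊₁ = g(θ̆ᵢ)`. -/
def breve (i : ℕ) : ℝ := g^[i] Real.pi

/-- `ρ_d = 2 sin θ̆_d / π + ((π - 2 θ̆_d) / π) ∑_{i<d} (sin θ̆ᵢ / π) ∏_{i<j<d} (π - θ̆ⱼ) / π`. -/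
def rho (d : ℕ) : ℝ :=
  2 * Real.sin (breve d) / Real.pi +
    (Real.pi - 2 * breve d) / Real.pi *
      ∑ i ∈ Finset.range d, Real.sin (breve i) / Real.pi *
        ∏ j ∈ Finset.Ico (i + 1) d, (Real.pi - breve j) / Real.pi

end DeepPR

end

/-!
For a non-zero `y`, let `Λ_y` be the linear map obtained by freezing the `relu` patterns of the
network at `y`, so that `G y = Λ_y y`. On a short ray `x + t v` the patterns at the points `t > 0`
do not change, hence the one-sided derivatives of the risk are bilinear expressions in `Λ_y` and
`A_{G y}`; the RRCP replaces `A_{G y}ᵀ A_{G z}` by `Φ_{G y, G z}` and the WDC controls `Λ_yᵀ Λ_z`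
layer by layer.

Suppose no one-sided derivative at `x ≠ 0` is negative, and let `θ_i` be the angle between the
`i`-th layers of `x` and `x₀`. Moving along `±x` forces `‖x‖ ≈ φ(θ_d) ‖x₀‖` with
`φ(θ) = ((π - 2θ) cos θ + 2 sin θ) / π`. Moving along the component `e` of `x₀` orthogonal to `x`
gives `(π - 2θ_d) / π * ∏ (π - θ_i) / π * ‖e‖ ≲ d² ε ‖x₀‖`. Since `θ_{i+1} ≈ g(θ_i)`, the angles
contract towards `0` like `1 / i`, so the product is at least `(π - θ_0) / π` times an inverse power
of `d`, and `d ≥ 2` keeps `θ_d` away from `π / 2`. Hence `sin θ_0` is small: if `θ_0` is near `0`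
then `θ_d ≈ 0` and `x ≈ φ(0) x₀ = x₀`, and if it is near `π` then `θ_d` is close to the `d`-th
iterate of `g` at `π` and `x ≈ -φ(θ_d) x₀ ≈ -ρ_d x₀`.
-/

noncomputable section

namespace DeepPR

open Real Set Filter Topology InnerProductGeometry

/-! ### The angle recursion -/

/-- The cosine of `g θ`, that is, the argument of its `arccos`. -/
def cosStep (θ : ℝ) : ℝ := (cos θ * (π - θ) + sin θ) / π

/-- The value of `⟨Φ_{z,w} w, z⟩` for unit vectors `z`, `w` at angle `θ`, which stands for the
correlation of `|A z|` and `|A w|`. -/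
def phaseFactor (θ : ℝ) : ℝ := ((π - 2 * θ) * cos θ + 2 * sin θ) / π

theorem zero_mem_Icc_pi : (0 : ℝ) ∈ Icc 0 π := ⟨le_rfl, pi_pos.le⟩

theorem pi_mem_Icc_pi : π ∈ Icc 0 π := ⟨pi_pos.le, le_rfl⟩

theorem pi_div_two_mem_Icc_pi : π / 2 ∈ Icc 0 π := ⟨pi_div_two_pos.le, half_le_self pi_pos.le⟩

theorem hasDerivAt_cosStep (θ : ℝ) : HasDerivAt cosStep (-(π - θ) * sin θ / π) θ := by
  have h := (((hasDerivAt_cos θ).mul ((hasDerivAt_id θ).const_sub π)).add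
    (hasDerivAt_sin θ)).div_const π
  refine HasDerivAt.congr_deriv h ?_
  simp only [id]
  ring

theorem hasDerivAt_phaseFactor (θ : ℝ) :
    HasDerivAt phaseFactor (-(π - 2 * θ) * sin θ / π) θ := by
  have h := (((((hasDerivAt_id θ).const_mul 2).const_sub π).mul (hasDerivAt_cos θ)).add
    ((hasDerivAt_sin θ).const_mul 2)).div_const π
  refine HasDerivAt.congr_deriv h ?_
  simp only [id]
  ring

theorem abs_sub_le_abs_cos_sub {u u' : ℝ → ℝ} (hu : ∀ θ ∈ Icc 0 π, HasDerivAt u (u' θ) θ)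
    (hu' : ∀ θ ∈ Icc 0 π, |u' θ| ≤ sin θ) {a b : ℝ} (ha : a ∈ Icc 0 π) (hb : b ∈ Icc 0 π) :
    |u a - u b| ≤ |cos a - cos b| := by
  wlog hab : a ≤ b generalizing a b
  · rw [abs_sub_comm, abs_sub_comm (cos a)]
    exact this hb ha (le_of_not_ge hab)
  rcases hab.eq_or_lt with rfl | hab
  · simp
  have hsub : Icc a b ⊆ Icc 0 π := Icc_subset_Icc ha.1 hb.2
  obtain ⟨c, hc, hslope⟩ := exists_ratio_hasDerivAt_eq_ratio_slope u u' hab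
    (fun θ hθ => (hu θ (hsub hθ)).continuousAt.continuousWithinAt)
    (fun θ hθ => hu θ (hsub (Ioo_subset_Icc_self hθ)))
    cos (fun θ => -sin θ) continuous_cos.continuousOn (fun θ _ => hasDerivAt_cos θ)
  have hsin : 0 < sin c := sin_pos_of_pos_of_lt_pi (ha.1.trans_lt hc.1) (hc.2.trans_le hb.2)
  refine le_of_mul_le_mul_right ?_ hsin
  calc |u a - u b| * sin c = |(u b - u a) * -sin c| := by
        rw [abs_mul, abs_neg, abs_of_pos hsin, abs_sub_comm]
    _ = |cos a - cos b| * |u' c| := by rw [← hslope, abs_mul, abs_sub_comm]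
    _ ≤ |cos a - cos b| * sin c := by gcongr; exact hu' c (hsub (Ioo_subset_Icc_self hc))

theorem abs_neg_mul_sin_div_pi_le {c θ : ℝ} (hc : |c| ≤ π) (hθ : θ ∈ Icc 0 π) :
    |-c * sin θ / π| ≤ sin θ := by
  have hsin := sin_nonneg_of_mem_Icc hθ
  rw [abs_div, abs_mul, abs_neg, abs_of_nonneg hsin, abs_of_pos pi_pos, div_le_iff₀ pi_pos,
    mul_comm (sin θ)]
  gcongr

theorem abs_cosStep_sub_le {a b : ℝ} (ha : a ∈ Icc 0 π) (hb : b ∈ Icc 0 π) :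
    |cosStep a - cosStep b| ≤ |cos a - cos b| :=
  abs_sub_le_abs_cos_sub (fun θ _ => hasDerivAt_cosStep θ) (fun _ hθ =>
    abs_neg_mul_sin_div_pi_le (abs_le.2 ⟨by linarith [hθ.2, pi_pos], by linarith [hθ.1]⟩) hθ) ha hb

theorem abs_phaseFactor_sub_le {a b : ℝ} (ha : a ∈ Icc 0 π) (hb : b ∈ Icc 0 π) :
    |phaseFactor a - phaseFactor b| ≤ |cos a - cos b| :=
  abs_sub_le_abs_cos_sub (fun θ _ => hasDerivAt_phaseFactor θ) (fun _ hθ =>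
    abs_neg_mul_sin_div_pi_le (abs_le.2 ⟨by linarith [hθ.2], by linarith [hθ.1]⟩) hθ) ha hb

theorem antitoneOn_cosStep : AntitoneOn cosStep (Icc 0 π) := by
  refine antitoneOn_of_hasDerivWithinAt_nonpos (f' := fun θ => -(π - θ) * sin θ / π)
    (convex_Icc 0 π) (fun θ _ => (hasDerivAt_cosStep θ).continuousAt.continuousWithinAt)
    (fun θ _ => (hasDerivAt_cosStep θ).hasDerivWithinAt) fun θ hθ => ?_
  have hθ' := interior_subset hθ
  have := mul_nonneg (sub_nonneg.2 hθ'.2) (sin_nonneg_of_mem_Icc hθ')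
  exact div_nonpos_of_nonpos_of_nonneg (by linarith) pi_pos.le

theorem cosStep_zero : cosStep 0 = 1 := by simp [cosStep, pi_ne_zero]

theorem cosStep_pi : cosStep π = 0 := by simp [cosStep]

theorem cosStep_pi_div_two : cosStep (π / 2) = 1 / π := by simp [cosStep]

theorem cosStep_mem_Icc {θ : ℝ} (hθ : θ ∈ Icc 0 π) : cosStep θ ∈ Icc 0 1 := by
  constructor
  · simpa only [cosStep_pi] using antitoneOn_cosStep hθ pi_mem_Icc_pi hθ.2
  · simpa only [cosStep_zero] using antitoneOn_cosStep zero_mem_Icc_pi hθ hθ.1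

theorem one_div_pi_sub_le_cosStep {θ δ : ℝ} (hθ : θ ∈ Icc 0 π) (hδ : 0 ≤ δ) (h : -δ ≤ cos θ) :
    1 / π - δ ≤ cosStep θ := by
  rw [← cosStep_pi_div_two]
  rcases le_total θ (π / 2) with hle | hge
  · linarith [antitoneOn_cosStep hθ pi_div_two_mem_Icc_pi hle]
  · have hcos := cos_nonpos_of_pi_div_two_le_of_le hge (by linarith [hθ.2, pi_pos])
    have hdiff := (abs_le.1 (abs_cosStep_sub_le hθ pi_div_two_mem_Icc_pi)).1
    rw [cos_pi_div_two, sub_zero, abs_of_nonpos hcos] at hdiff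
    linarith

theorem phaseFactor_zero : phaseFactor 0 = 1 := by simp [phaseFactor, pi_ne_zero]

theorem phaseFactor_pi_div_two : phaseFactor (π / 2) = 2 / π := by simp [phaseFactor]

theorem two_div_pi_le_phaseFactor {θ : ℝ} (hθ : θ ∈ Icc 0 π) : 2 / π ≤ phaseFactor θ := by
  have hsq : cos θ ^ 2 ≤ (π / 2 - θ) * cos θ := by
    rcases le_total θ (π / 2) with hle | hge
    · have hsin : cos θ ≤ π / 2 - θ := by
        rw [← sin_pi_div_two_sub]
        exact sin_le (by linarith)
      have hcos : 0 ≤ cos θ := cos_nonneg_of_mem_Icc ⟨by linarith [hθ.1, pi_pos], hle⟩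
      nlinarith
    · have hsin : -cos θ ≤ θ - π / 2 := by
        rw [← sin_sub_pi_div_two]
        exact sin_le (by linarith)
      have hcos : cos θ ≤ 0 := cos_nonpos_of_pi_div_two_le_of_le hge (by linarith [hθ.2, pi_pos])
      nlinarith
  have hsin_sq : sin θ ^ 2 ≤ sin θ :=
    pow_le_of_le_one (sin_nonneg_of_mem_Icc hθ) (sin_le_one θ) two_ne_zero
  unfold phaseFactor
  gcongr
  linarith [sin_sq_add_cos_sq θ]

theorem phaseFactor_le_two {θ : ℝ} (hθ : θ ∈ Icc 0 π) : phaseFactor θ ≤ 2 := by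
  have hdiff := (abs_le.1 (abs_phaseFactor_sub_le hθ pi_div_two_mem_Icc_pi)).2
  rw [phaseFactor_pi_div_two, cos_pi_div_two, sub_zero] at hdiff
  have hπ : 2 / π ≤ 1 := (div_le_one pi_pos).2 two_le_pi
  linarith [abs_cos_le_one θ]

theorem sin_half_nonneg {θ : ℝ} (hθ : θ ∈ Icc 0 π) : 0 ≤ sin (θ / 2) :=
  sin_nonneg_of_nonneg_of_le_pi (by linarith [hθ.1]) (by linarith [hθ.2, pi_pos])

theorem sin_half_sq (θ : ℝ) : sin (θ / 2) ^ 2 = (1 - cos θ) / 2 := by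
  rw [sin_sq_eq_half_sub, mul_div_cancel₀ θ two_ne_zero]
  ring

theorem pi_div_two_mul_sin_half_pow_le {θ : ℝ} (hθ : θ ∈ Icc 0 π) :
    π / 2 * sin (θ / 2) ^ 3 ≤ sin θ - θ * cos θ := by
  have hderiv (t : ℝ) : HasDerivAt (fun t => sin t - t * cos t - π / 2 * sin (t / 2) ^ 3)
      (sin (t / 2) * cos (t / 2) * (2 * t - 3 * π / 4 * sin (t / 2))) t := by
    have h := ((hasDerivAt_sin t).sub ((hasDerivAt_id t).mul (hasDerivAt_cos t))).sub
      ((((hasDerivAt_id t).div_const 2).sin.pow 3).const_mul (π / 2))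
    refine HasDerivAt.congr_deriv h ?_
    have hdouble : sin t = 2 * sin (t / 2) * cos (t / 2) := by
      rw [← sin_two_mul, mul_div_cancel₀ t two_ne_zero]
    simp only [id]
    push_cast
    rw [hdouble]
    ring
  have hmono : MonotoneOn (fun t => sin t - t * cos t - π / 2 * sin (t / 2) ^ 3) (Icc 0 π) := by
    refine monotoneOn_of_hasDerivWithinAt_nonneg (convex_Icc 0 π)
      (fun t _ => (hderiv t).continuousAt.continuousWithinAt)
      (fun t _ => (hderiv t).hasDerivWithinAt) fun t ht => ?_
    obtain ⟨ht0, htπ⟩ := interior_subset ht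
    have hsin : sin (t / 2) ≤ t / 2 := sin_le (by linarith)
    have hcos : 0 ≤ cos (t / 2) := cos_nonneg_of_mem_Icc ⟨by linarith [pi_pos], by linarith⟩
    have hlin : 3 * π / 4 * sin (t / 2) ≤ 2 * t := by nlinarith [pi_le_four, pi_pos]
    exact mul_nonneg (mul_nonneg (sin_half_nonneg ⟨ht0, htπ⟩) hcos) (sub_nonneg.2 hlin)
  have h := hmono zero_mem_Icc_pi hθ hθ.1
  simp only [sin_zero, zero_mul, sub_zero, zero_div, ne_eq, OfNat.ofNat_ne_zero,
    not_false_eq_true, zero_pow, mul_zero] at h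
  linarith

theorem one_sub_cosStep_half_le {θ : ℝ} (hθ : θ ∈ Icc 0 π) :
    (1 - cosStep θ) / 2 ≤ sin (θ / 2) ^ 2 - sin (θ / 2) ^ 3 / 4 := by
  have hstep : cosStep θ = cos θ + (sin θ - θ * cos θ) / π := by
    unfold cosStep
    field_simp
    ring
  have hgain : sin (θ / 2) ^ 3 / 2 ≤ (sin θ - θ * cos θ) / π := by
    rw [le_div_iff₀ pi_pos]
    linarith [pi_div_two_mul_sin_half_pow_le hθ]
  rw [sin_half_sq, hstep]
  linarith

theorem twelve_div_sq_sub_cube_add_le {u δ : ℝ} (hu : 0 < u) (hδ : δ * u ^ 3 ≤ 288) :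
    (12 / u) ^ 2 - (12 / u) ^ 3 / 4 + δ / 2 ≤ (12 / (u + 1)) ^ 2 := by
  have hδ' : δ ≤ 288 / u ^ 3 := (le_div_iff₀ (by positivity)).2 hδ
  calc (12 / u) ^ 2 - (12 / u) ^ 3 / 4 + δ / 2
      ≤ (12 / u) ^ 2 - (12 / u) ^ 3 / 4 + 288 / u ^ 3 / 2 := by gcongr
    _ = 144 * (u - 2) / u ^ 3 := by field_simp; ring
    _ ≤ 144 / (u + 1) ^ 2 := by
      rw [div_le_div_iff₀ (by positivity) (by positivity)]
      nlinarith
    _ = (12 / (u + 1)) ^ 2 := by field_simp; norm_num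

theorem sq_sub_cube_div_four_le {s w : ℝ} (hs : 0 ≤ s) (hsw : s ≤ w) (hw : w ≤ 1) :
    s ^ 2 - s ^ 3 / 4 ≤ w ^ 2 - w ^ 3 / 4 := by
  have hfactor : 0 ≤ w + s - (w ^ 2 + w * s + s ^ 2) / 4 := by nlinarith
  nlinarith [mul_nonneg (sub_nonneg.2 hsw) hfactor]

-- In terms of `s = sin (θ / 2)` the recursion reads `s'² ≤ s² - s³ / 4 + δ / 2`, and
-- `12 / (i + 12)` is a supersolution of it.
theorem sin_half_le_of_cosStep_le {θ : ℕ → ℝ} {δ : ℝ} {d : ℕ} (hθ : ∀ i, θ i ∈ Icc 0 π)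
    (hδ : 0 ≤ δ) (hδd : δ * (d + 12) ^ 3 ≤ 288)
    (hstep : ∀ i < d, cosStep (θ i) - δ ≤ cos (θ (i + 1))) :
    ∀ i ≤ d, sin (θ i / 2) ≤ 12 / (i + 12) := by
  intro i
  induction i with
  | zero =>
    intro _
    simpa using sin_le_one (θ 0 / 2)
  | succ i ih =>
    intro hi
    have hid : (i : ℝ) ≤ d := by exact_mod_cast (Nat.le_succ i).trans hi
    have hw : 12 / ((i : ℝ) + 12) ≤ 1 := by
      rw [div_le_one (by positivity)]
      linarith [i.cast_nonneg (α := ℝ)]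
    have hsq : sin (θ (i + 1) / 2) ^ 2 ≤ (12 / ((i : ℝ) + 12 + 1)) ^ 2 :=
      calc sin (θ (i + 1) / 2) ^ 2 ≤ (1 - cosStep (θ i)) / 2 + δ / 2 := by
            rw [sin_half_sq]
            linarith [hstep i hi]
        _ ≤ sin (θ i / 2) ^ 2 - sin (θ i / 2) ^ 3 / 4 + δ / 2 := by
            gcongr
            exact one_sub_cosStep_half_le (hθ i)
        _ ≤ (12 / ((i : ℝ) + 12)) ^ 2 - (12 / ((i : ℝ) + 12)) ^ 3 / 4 + δ / 2 := by
            linarith [sq_sub_cube_div_four_le (sin_half_nonneg (hθ i)) (ih (by omega)) hw]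
        _ ≤ _ := twelve_div_sq_sub_cube_add_le (by positivity) (le_trans (by gcongr) hδd)
    push_cast
    rw [add_right_comm]
    exact (abs_le_of_sq_le_sq' hsq (by positivity)).2

theorem div_add_one_pow_le {x : ℝ} (hx : 0 < x) (n : ℕ) : (x / (x + 1)) ^ n ≤ x / (x + n) := by
  have hbernoulli : 1 + n * (1 / x) ≤ (1 + 1 / x) ^ n :=
    one_add_mul_le_pow (by linarith [one_div_pos.2 hx]) n
  calc (x / (x + 1)) ^ n = ((1 + 1 / x) ^ n)⁻¹ := by
        rw [← inv_pow]
        congr 1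
        field_simp
    _ ≤ (1 + n * (1 / x))⁻¹ := by gcongr
    _ = x / (x + n) := by field_simp

theorem div_add_twelve_le_of_sin_half_le {θ x : ℝ} (hθ : θ ∈ Icc 0 π) (hx : 0 ≤ x)
    (h : sin (θ / 2) ≤ 12 / (x + 12)) : x / (x + 12) ≤ (π - θ) / π := by
  have hjordan : θ / π ≤ sin (θ / 2) :=
    calc θ / π = 2 / π * (θ / 2) := by ring
      _ ≤ _ := mul_le_sin (by linarith [hθ.1]) (by linarith [hθ.2])
  calc x / (x + 12) = 1 - 12 / (x + 12) := by field_simp; ring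
    _ ≤ 1 - θ / π := by linarith
    _ = (π - θ) / π := by field_simp

theorem le_prod_pi_sub_div_pi {θ : ℕ → ℝ} (hθ : ∀ i, θ i ∈ Icc 0 π) {d : ℕ} (hd : 1 ≤ d)
    (h : ∀ i < d, sin (θ i / 2) ≤ 12 / (i + 12)) :
    (π - θ 0) / π * (1 / (d : ℝ) ^ 12) ≤ ∏ i ∈ Finset.range d, (π - θ i) / π := by
  have hfactor : ∀ i, 0 ≤ (π - θ i) / π := fun i => div_nonneg (by linarith [(hθ i).2]) pi_pos.le
  induction d, hd using Nat.le_induction with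
  | base => simp
  | succ d hd ih =>
    have hd0 : (0 : ℝ) < d := by exact_mod_cast hd
    have hstep : ((d : ℝ) / (d + 1)) ^ 12 ≤ (π - θ d) / π :=
      (div_add_one_pow_le hd0 12).trans
        (div_add_twelve_le_of_sin_half_le (hθ d) hd0.le (h d (by omega)))
    rw [Finset.prod_range_succ]
    calc (π - θ 0) / π * (1 / ((d + 1 : ℕ) : ℝ) ^ 12)
        = (π - θ 0) / π * (1 / (d : ℝ) ^ 12) * ((d : ℝ) / (d + 1)) ^ 12 := by
          push_cast
          field_simp
      _ ≤ _ := mul_le_mul (ih fun i hi => h i (by omega)) hstep (by positivity)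
          (Finset.prod_nonneg fun i _ => hfactor i)

theorem g_mem_Icc (θ : ℝ) : g θ ∈ Icc 0 π := ⟨arccos_nonneg _, arccos_le_pi _⟩

theorem cos_g {θ : ℝ} (hθ : θ ∈ Icc 0 π) : cos (g θ) = cosStep θ :=
  cos_arccos (neg_one_lt_zero.le.trans (cosStep_mem_Icc hθ).1) (cosStep_mem_Icc hθ).2

theorem g_zero : g 0 = 0 := by
  rw [g, ← cosStep, cosStep_zero, arccos_one]

theorem iterate_g_mem_Icc {ψ : ℝ} (hψ : ψ ∈ Icc 0 π) (i : ℕ) : g^[i] ψ ∈ Icc 0 π := by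
  cases i with
  | zero => exact hψ
  | succ i =>
    rw [Function.iterate_succ_apply']
    exact g_mem_Icc _

theorem cos_iterate_g_succ {ψ : ℝ} (hψ : ψ ∈ Icc 0 π) (i : ℕ) :
    cos (g^[i + 1] ψ) = cosStep (g^[i] ψ) := by
  rw [Function.iterate_succ_apply', cos_g (iterate_g_mem_Icc hψ i)]

theorem abs_cos_sub_cos_iterate_le {θ : ℕ → ℝ} {δ : ℝ} {d : ℕ} (hθ : ∀ i, θ i ∈ Icc 0 π)
    (hstep : ∀ i < d, |cos (θ (i + 1)) - cosStep (θ i)| ≤ δ) {ψ : ℝ} (hψ : ψ ∈ Icc 0 π) :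
    ∀ i ≤ d, |cos (θ i) - cos (g^[i] ψ)| ≤ |cos (θ 0) - cos ψ| + i * δ := by
  intro i
  induction i with
  | zero => intro _; simp
  | succ i ih =>
    intro hi
    rw [cos_iterate_g_succ hψ]
    calc |cos (θ (i + 1)) - cosStep (g^[i] ψ)|
        ≤ |cos (θ (i + 1)) - cosStep (θ i)| + |cosStep (θ i) - cosStep (g^[i] ψ)| :=
          abs_sub_le _ _ _
      _ ≤ δ + |cos (θ i) - cos (g^[i] ψ)| :=
          add_le_add (hstep i hi) (abs_cosStep_sub_le (hθ i) (iterate_g_mem_Icc hψ i))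
      _ ≤ δ + (|cos (θ 0) - cos ψ| + i * δ) := by gcongr; exact ih (by omega)
      _ = _ := by push_cast; ring

theorem breve_mem_Icc (i : ℕ) : breve i ∈ Icc 0 π := iterate_g_mem_Icc pi_mem_Icc_pi i

theorem cos_breve_succ (i : ℕ) : cos (breve (i + 1)) = cosStep (breve i) :=
  cos_iterate_g_succ pi_mem_Icc_pi i

theorem sum_sin_breve_mul_prod (d : ℕ) :
    ∑ i ∈ Finset.range d, sin (breve i) / π * ∏ j ∈ Finset.Ico (i + 1) d, (π - breve j) / π =
      cos (breve d) + ∏ j ∈ Finset.range d, (π - breve j) / π := by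
  induction d with
  | zero => simp [breve]
  | succ d ih =>
    have hfactor : ∑ i ∈ Finset.range d, sin (breve i) / π *
          ∏ j ∈ Finset.Ico (i + 1) (d + 1), (π - breve j) / π =
        (∑ i ∈ Finset.range d, sin (breve i) / π *
          ∏ j ∈ Finset.Ico (i + 1) d, (π - breve j) / π) * ((π - breve d) / π) := by
      rw [Finset.sum_mul]
      refine Finset.sum_congr rfl fun i hi => ?_
      rw [Finset.prod_Ico_succ_top (Finset.mem_range.1 hi), mul_assoc]
    rw [Finset.sum_range_succ, Finset.prod_range_succ, cos_breve_succ, hfactor, ih, cosStep,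
      Finset.Ico_self, Finset.prod_empty]
    ring

theorem rho_eq_phaseFactor {d : ℕ} (hd : 1 ≤ d) : rho d = phaseFactor (breve d) := by
  have hprod : ∏ j ∈ Finset.range d, (π - breve j) / π = 0 :=
    Finset.prod_eq_zero (Finset.mem_range.2 hd) (by simp [breve])
  rw [rho, sum_sin_breve_mul_prod, hprod, phaseFactor]
  ring

theorem rho_pos {d : ℕ} (hd : 1 ≤ d) : 0 < rho d := by
  rw [rho_eq_phaseFactor hd]
  exact (div_pos two_pos pi_pos).trans_le (two_div_pi_le_phaseFactor (breve_mem_Icc d))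

theorem sin_half_breve_le (d : ℕ) : sin (breve d / 2) ≤ 12 / (d + 12) :=
  sin_half_le_of_cosStep_le breve_mem_Icc le_rfl (by simp)
    (fun i _ => by rw [cos_breve_succ, sub_zero]) d le_rfl

theorem abs_rho_sub_one_le {d : ℕ} (hd : 1 ≤ d) : |rho d - 1| ≤ 2 * (12 / (d + 12)) ^ 2 :=
  calc |rho d - 1| ≤ |cos (breve d) - 1| := by
        simpa only [rho_eq_phaseFactor hd, phaseFactor_zero, cos_zero] using
          abs_phaseFactor_sub_le (breve_mem_Icc d) zero_mem_Icc_pi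
    _ = 2 * sin (breve d / 2) ^ 2 := by
        rw [sin_half_sq, abs_sub_comm, abs_of_nonneg (sub_nonneg.2 (cos_le_one _))]
        ring
    _ ≤ _ := by
        gcongr
        exacts [sin_half_nonneg (breve_mem_Icc d), sin_half_breve_le d]

theorem tendsto_rho : Tendsto rho atTop (𝓝 1) := by
  have hdecay : Tendsto (fun d : ℕ => 12 / ((d : ℝ) + 12)) atTop (𝓝 0) :=
    tendsto_const_nhds.div_atTop (tendsto_atTop_add_const_right _ _ tendsto_natCast_atTop_atTop)
  have hbound : Tendsto (fun d : ℕ => 2 * (12 / ((d : ℝ) + 12)) ^ 2) atTop (𝓝 0) := by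
    simpa using (hdecay.pow 2).const_mul 2
  rw [tendsto_iff_dist_tendsto_zero]
  refine squeeze_zero' (Eventually.of_forall fun _ => dist_nonneg) ?_ hbound
  filter_upwards [eventually_ge_atTop 1] with d hd
  exact abs_rho_sub_one_le hd

/-! ### One-sided derivatives of the risk -/

theorem inner_toEuclideanCLM_transpose_mul {m k : ℕ} (B C : Matrix (Fin m) (Fin k) ℝ)
    (u v : E k) :
    inner ℝ (Matrix.toEuclideanCLM (𝕜 := ℝ) (B.transpose * C) u) v =
      inner ℝ (Matrix.toEuclideanLin C u) (Matrix.toEuclideanLin B v) := by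
  have hadjoint : Matrix.toEuclideanCLM (𝕜 := ℝ) (B.transpose * C) u =
      (Matrix.toEuclideanLin B).adjoint (Matrix.toEuclideanLin C u) := by
    rw [← Matrix.toEuclideanLin_conjTranspose_eq_adjoint,
      Matrix.conjTranspose_eq_transpose_of_trivial]
    ext i
    simp [Matrix.toLpLin_apply, Matrix.mulVec_mulVec]
  rw [hadjoint, LinearMap.adjoint_inner_left]

theorem toEuclideanLin_diagonal_mul_apply {m k : ℕ} (s : Fin m → ℝ)
    (B : Matrix (Fin m) (Fin k) ℝ) (u : E k) (i : Fin m) :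
    Matrix.toEuclideanLin (Matrix.diagonal s * B) u i = s i * Matrix.toEuclideanLin B u i := by
  simp only [Matrix.toLpLin_apply]
  rw [← Matrix.mulVec_mulVec, Matrix.mulVec_diagonal]

theorem sign_mul_eq_abs (a : ℝ) : Real.sign a * a = |a| := by
  rcases lt_trichotomy a 0 with h | rfl | h
  · rw [Real.sign_of_neg h, abs_of_neg h, neg_one_mul]
  · simp
  · rw [Real.sign_of_pos h, abs_of_pos h, one_mul]

theorem sign_pos_iff_pos {a : ℝ} : 0 < Real.sign a ↔ 0 < a := by
  rcases lt_trichotomy a 0 with h | rfl | h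
  · exact iff_of_false (by norm_num [Real.sign_of_neg h]) h.not_gt
  · simp
  · simp [Real.sign_of_pos h, h]

theorem sign_mul_of_pos {t : ℝ} (ht : 0 < t) (b : ℝ) : Real.sign (t * b) = Real.sign b := by
  rcases lt_trichotomy b 0 with h | rfl | h
  · rw [Real.sign_of_neg h, Real.sign_of_neg (mul_neg_of_pos_of_neg ht h)]
  · rw [mul_zero]
  · rw [Real.sign_of_pos h, Real.sign_of_pos (mul_pos ht h)]

theorem relu_eq_posRows {n k : ℕ} (W : Matrix (Fin n) (Fin k) ℝ) (x : E k) :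
    relu (Matrix.toEuclideanLin W x) = Matrix.toEuclideanLin (posRows W x) x := by
  ext i
  rw [posRows, toEuclideanLin_diagonal_mul_apply]
  simp only [relu]
  split_ifs with h
  · rw [max_eq_left h.le, one_mul]
  · rw [max_eq_right (not_lt.1 h), zero_mul]

theorem absVec_eq_signRows {m n : ℕ} (A : Matrix (Fin m) (Fin n) ℝ) (z : E n) :
    absVec (Matrix.toEuclideanLin A z) = Matrix.toEuclideanLin (signRows A z) z := by
  ext i
  rw [signRows, toEuclideanLin_diagonal_mul_apply]
  exact (sign_mul_eq_abs _).symm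

theorem absVec_smul {n : ℕ} (t : ℝ) (z : E n) : absVec (t • z) = |t| • absVec z := by
  ext i
  simp [absVec, abs_mul]

theorem continuous_relu {n : ℕ} : Continuous (relu : E n → E n) := by
  unfold relu
  fun_prop

theorem continuous_absVec {n : ℕ} : Continuous (absVec : E n → E n) := by
  unfold absVec
  fun_prop

section Network

variable {n : ℕ → ℕ} (W : ∀ i, Matrix (Fin (n (i + 1))) (Fin (n i)) ℝ)

/-- The linear map `Λ_y = W_{i,+,y} ⋯ W_{1,+,y}` obtained by freezing the activation pattern of
the network at `y`; on vectors with the same pattern as `y` it agrees with `gen W i`. -/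
def genLin (y : E (n 0)) : ∀ i, E (n 0) →ₗ[ℝ] E (n i)
  | 0 => LinearMap.id
  | i + 1 => Matrix.toEuclideanLin (posRows (W i) (gen W i y)) ∘ₗ genLin y i

theorem genLin_succ_apply (y u : E (n 0)) (i : ℕ) :
    genLin W y (i + 1) u =
      Matrix.toEuclideanLin (posRows (W i) (gen W i y)) (genLin W y i u) := rfl

theorem genLin_apply_self (y : E (n 0)) (i : ℕ) : genLin W y i y = gen W i y := by
  induction i with
  | zero => rfl
  | succ i ih => rw [genLin_succ_apply, ih, gen, relu_eq_posRows]

theorem continuous_gen (i : ℕ) : Continuous (gen W i) := by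
  induction i with
  | zero => exact continuous_id
  | succ i ih =>
    exact continuous_relu.comp ((LinearMap.continuous_of_finiteDimensional _).comp ih)

theorem gen_smul (i : ℕ) (x : E (n 0)) {t : ℝ} (ht : 0 ≤ t) :
    gen W i (t • x) = t • gen W i x := by
  induction i with
  | zero => rfl
  | succ i ih =>
    ext j
    simp only [gen, ih, map_smul, relu, PiLp.smul_apply, smul_eq_mul]
    rw [mul_max_of_nonneg _ _ ht, mul_zero]

theorem gen_zero_right (i : ℕ) : gen W i 0 = 0 := by
  simpa using gen_smul W i 0 (le_refl (0 : ℝ))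

end Network

theorem tendsto_add_smul_nhdsGT_zero {V : Type*} [NormedAddCommGroup V] [NormedSpace ℝ V]
    (u w : V) : Tendsto (fun t : ℝ => u + t • w) (𝓝[>] 0) (𝓝 u) := by
  have h : Continuous fun t : ℝ => u + t • w := by fun_prop
  simpa only [zero_smul, add_zero] using (h.tendsto 0).mono_left nhdsWithin_le_nhds

theorem eventually_add_smul_ne_zero {V : Type*} [NormedAddCommGroup V] [NormedSpace ℝ V] {x : V}
    (w : V) (hx : x ≠ 0) : ∀ᶠ t in 𝓝[>] (0 : ℝ), x + t • w ≠ 0 :=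
  (tendsto_add_smul_nhdsGT_zero x w).eventually (isOpen_ne.mem_nhds hx)

theorem tendsto_angle_add_smul {V : Type*} [NormedAddCommGroup V] [InnerProductSpace ℝ V]
    {x z : V} (w : V) (hx : x ≠ 0) (hz : z ≠ 0) :
    Tendsto (fun t : ℝ => angle (x + t • w) z) (𝓝[>] 0) (𝓝 (angle x z)) := by
  have hcont : ContinuousAt (fun y : V => angle y z) x :=
    ContinuousAt.comp (f := fun y => (y, z)) (continuousAt_angle hx hz) (by fun_prop)
  exact hcont.tendsto.comp (tendsto_add_smul_nhdsGT_zero x w)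

theorem exists_eventually_sign_add_mul_eq (a b : ℝ) :
    ∃ σ, ∀ᶠ t in 𝓝[>] (0 : ℝ), Real.sign (a + t * b) = σ := by
  have hlim : Tendsto (fun t : ℝ => a + t * b) (𝓝[>] 0) (𝓝 a) := tendsto_add_smul_nhdsGT_zero a b
  rcases lt_trichotomy a 0 with ha | rfl | ha
  · exact ⟨-1, (hlim.eventually (gt_mem_nhds ha)).mono fun t => Real.sign_of_neg⟩
  · refine ⟨Real.sign b, eventually_mem_nhdsWithin.mono fun t (ht : 0 < t) => ?_⟩
    rw [zero_add, sign_mul_of_pos ht]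
  · exact ⟨1, (hlim.eventually (lt_mem_nhds ha)).mono fun t => Real.sign_of_pos⟩

theorem exists_eventually_sign_toEuclideanLin_eq {m k : ℕ} (B : Matrix (Fin m) (Fin k) ℝ)
    (u w : E k) : ∃ σ : Fin m → ℝ, ∀ᶠ t in 𝓝[>] (0 : ℝ), ∀ i,
      Real.sign (Matrix.toEuclideanLin B (u + t • w) i) = σ i := by
  choose σ hσ using fun i =>
    exists_eventually_sign_add_mul_eq (Matrix.toEuclideanLin B u i) (Matrix.toEuclideanLin B w i)
  refine ⟨σ, eventually_all.2 fun i => ?_⟩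
  simpa only [map_add, map_smul, PiLp.add_apply, PiLp.smul_apply, smul_eq_mul] using hσ i

theorem exists_eventually_signRows_eq {m k : ℕ} (A : Matrix (Fin m) (Fin k) ℝ) (u w : E k) :
    ∃ S, ∀ᶠ t in 𝓝[>] (0 : ℝ), signRows A (u + t • w) = S := by
  obtain ⟨σ, hσ⟩ := exists_eventually_sign_toEuclideanLin_eq A u w
  refine ⟨Matrix.diagonal σ * A, hσ.mono fun t ht => ?_⟩
  rw [signRows, funext ht]

theorem exists_eventually_posRows_eq {m k : ℕ} (B : Matrix (Fin m) (Fin k) ℝ) (u w : E k) :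
    ∃ P, ∀ᶠ t in 𝓝[>] (0 : ℝ), posRows B (u + t • w) = P := by
  obtain ⟨σ, hσ⟩ := exists_eventually_sign_toEuclideanLin_eq B u w
  refine ⟨Matrix.diagonal (fun i => if 0 < σ i then (1 : ℝ) else 0) * B, hσ.mono fun t ht => ?_⟩
  simp only [posRows, ← ht, sign_pos_iff_pos]

theorem exists_eventually_genLin_eq {n : ℕ → ℕ}
    (W : ∀ i, Matrix (Fin (n (i + 1))) (Fin (n i)) ℝ) (x v : E (n 0)) (i : ℕ) :
    ∃ L, ∀ᶠ t in 𝓝[>] (0 : ℝ), genLin W (x + t • v) i = L := by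
  induction i with
  | zero => exact ⟨LinearMap.id, Eventually.of_forall fun _ => rfl⟩
  | succ i ih =>
    obtain ⟨L, hL⟩ := ih
    obtain ⟨P, hP⟩ := exists_eventually_posRows_eq (W i) (L x) (L v)
    refine ⟨Matrix.toEuclideanLin P ∘ₗ L, ?_⟩
    filter_upwards [hL, hP] with t hLt hPt
    rw [genLin, hLt, ← genLin_apply_self, hLt, map_add, map_smul, hPt]

theorem exists_eventually_genLin_eq_and_apply {n : ℕ → ℕ}
    (W : ∀ i, Matrix (Fin (n (i + 1))) (Fin (n i)) ℝ) (x v : E (n 0)) (i : ℕ) :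
    ∃ L, L x = gen W i x ∧ ∀ᶠ t in 𝓝[>] (0 : ℝ), genLin W (x + t • v) i = L := by
  obtain ⟨L, hL⟩ := exists_eventually_genLin_eq W x v i
  have hgen : Tendsto (fun t : ℝ => gen W i (x + t • v)) (𝓝[>] 0) (𝓝 (gen W i x)) :=
    ((continuous_gen W i).tendsto x).comp (tendsto_add_smul_nhdsGT_zero x v)
  have hlin : Tendsto (fun t : ℝ => L x + t • L v) (𝓝[>] 0) (𝓝 (L x)) :=
    tendsto_add_smul_nhdsGT_zero _ _
  refine ⟨L, tendsto_nhds_unique_of_eventuallyEq hlin hgen ?_, hL⟩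
  filter_upwards [hL] with t ht
  rw [← genLin_apply_self, ht, map_add, map_smul]

theorem hasOneSidedDeriv_of_eventually_eq {k m : ℕ} {f : E k → ℝ} (hf : Continuous f)
    {x v : E k} {a b : E m}
    (h : ∀ᶠ t in 𝓝[>] (0 : ℝ), f (x + t • v) = 1 / 2 * ‖a + t • b‖ ^ 2) :
    HasOneSidedDeriv f x v (inner ℝ a b) := by
  have hfx : f x = 1 / 2 * ‖a‖ ^ 2 :=
    tendsto_nhds_unique_of_eventuallyEq
      ((hf.tendsto x).comp (tendsto_add_smul_nhdsGT_zero x v))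
      (((tendsto_add_smul_nhdsGT_zero a b).norm.pow 2).const_mul (1 / 2)) h
  have hlim : Tendsto (fun t : ℝ => inner ℝ a b + t * (1 / 2 * ‖b‖ ^ 2)) (𝓝[>] 0)
      (𝓝 (inner ℝ a b)) :=
    tendsto_add_smul_nhdsGT_zero (inner ℝ a b) (1 / 2 * ‖b‖ ^ 2)
  refine hlim.congr' ?_
  filter_upwards [h, self_mem_nhdsWithin] with t ht ht0
  have ht0 : t ≠ 0 := (mem_Ioi.1 ht0).ne'
  rw [ht, hfx, norm_add_sq_real, real_inner_smul_right, norm_smul, mul_pow, norm_eq_abs, sq_abs]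
  field_simp
  ring

theorem swapMap_apply_right {k : ℕ} {x y : E k} (hx : x ≠ 0) (hy : y ≠ 0) :
    swapMap x y y = (‖y‖ / ‖x‖) • x := by
  have hhat : y = ‖y‖ • hat y := by simp [hat, smul_smul, norm_ne_zero_iff.mpr hy]
  calc swapMap x y y = swapMap x y (‖y‖ • hat y) := by rw [← hhat]
    _ = (‖y‖ / ‖x‖) • x := by
      rw [map_smul, swapMap_hat_right hx hy, hat, smul_smul, div_eq_mul_inv]

theorem inner_Q_right {k : ℕ} {x y : E k} (hx : x ≠ 0) (hy : y ≠ 0) (v : E k) :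
    inner ℝ (Q x y y) v = (π - angle x y) / (2 * π) * inner ℝ y v +
      sin (angle x y) / (2 * π) * (‖y‖ / ‖x‖) * inner ℝ x v := by
  simp only [Q, add_apply, smul_apply, ContinuousLinearMap.id_apply, swapMap_apply_right hx hy,
    inner_add_left, real_inner_smul_left]
  ring

theorem inner_Q_self {k : ℕ} {x : E k} (hx : x ≠ 0) (u v : E k) :
    inner ℝ (Q x x u) v = 1 / 2 * inner ℝ u v := by
  simp only [Q, add_apply, smul_apply, ContinuousLinearMap.id_apply, inner_add_left,
    real_inner_smul_left, angle_self hx, sin_zero, zero_div, zero_mul, add_zero, sub_zero]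
  field_simp

theorem inner_Phi_right {n : ℕ} {z w : E n} (hz : z ≠ 0) (hw : w ≠ 0) (v : E n) :
    inner ℝ (Phi z w w) v = (π - 2 * angle z w) / π * inner ℝ w v +
      2 * sin (angle z w) / π * (‖w‖ / ‖z‖) * inner ℝ z v := by
  simp only [Phi, add_apply, smul_apply, ContinuousLinearMap.id_apply, swapMap_apply_right hz hw,
    inner_add_left, real_inner_smul_left]
  ring

theorem Phi_self {n : ℕ} {z : E n} (hz : z ≠ 0) : Phi z z = ContinuousLinearMap.id ℝ (E n) := by
  ext u
  simp [Phi, angle_self hz, pi_ne_zero]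

theorem inner_Phi_right_left {n : ℕ} {z w : E n} (hz : z ≠ 0) (hw : w ≠ 0) :
    inner ℝ (Phi z w w) z = phaseFactor (angle z w) * (‖z‖ * ‖w‖) := by
  have hnorm := norm_ne_zero_iff.2 hz
  rw [inner_Phi_right hz hw, real_inner_self_eq_norm_sq, real_inner_comm,
    ← cos_angle_mul_norm_mul_norm, phaseFactor]
  field_simp

theorem angle_mem_Icc {V : Type*} [NormedAddCommGroup V] [InnerProductSpace ℝ V] (x y : V) :
    angle x y ∈ Icc 0 π := ⟨angle_nonneg x y, angle_le_pi x y⟩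

section RRCP

variable {k n m : ℕ} {G : E k → E n} {A : Matrix (Fin m) (Fin n) ℝ} {ε : ℝ}

theorem RRCP.abs_inner_signRows_sub_le (hA : RRCP G A ε) (hG₀ : G 0 = 0) {y z : E k}
    (hy : y ≠ 0) (hz : z ≠ 0) (p : E k) {q r : E k} {t : ℝ} {b : E n} (ht : 0 < t)
    (hb : G q - G r = t • b) :
    |inner ℝ (Matrix.toEuclideanLin (signRows A (G z)) (G p))
        (Matrix.toEuclideanLin (signRows A (G y)) b) - inner ℝ (Phi (G y) (G z) (G p)) b| ≤
      7 * ε * ‖G p‖ * ‖b‖ := by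
  have h := hA y z hy hz p 0 q r
  rw [hb, hG₀, sub_zero, sub_apply, inner_sub_left, inner_toEuclideanCLM_transpose_mul, map_smul,
    inner_smul_right, inner_smul_right, ← mul_sub, norm_smul, norm_eq_abs, abs_mul,
    abs_of_pos ht, mul_left_comm] at h
  exact le_of_mul_le_mul_left h ht

theorem RRCP.abs_inner_absVec_sub_le (hA : RRCP G A ε) (hG₀ : G 0 = 0) {x z : E k}
    (hGx : G x ≠ 0) (hGz : G z ≠ 0) :
    |inner ℝ (absVec (Matrix.toEuclideanLin A (G z))) (absVec (Matrix.toEuclideanLin A (G x))) -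
      phaseFactor (angle (G x) (G z)) * (‖G x‖ * ‖G z‖)| ≤ 7 * ε * (‖G x‖ * ‖G z‖) := by
  have hne {y : E k} (hy : G y ≠ 0) : y ≠ 0 := by
    rintro rfl
    exact hy hG₀
  have h := hA.abs_inner_signRows_sub_le hG₀ (hne hGx) (hne hGz) z one_pos
    (show G x - G 0 = (1 : ℝ) • G x by rw [hG₀, sub_zero, one_smul])
  rw [inner_Phi_right_left hGx hGz] at h
  rw [absVec_eq_signRows, absVec_eq_signRows]
  exact h.trans_eq (by ring)

end RRCP

theorem continuous_risk {k n m : ℕ} {G : E k → E n} (hG : Continuous G)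
    (A : Matrix (Fin m) (Fin n) ℝ) (x₀ : E k) : Continuous (risk G A x₀) := by
  have hA : Continuous fun x => absVec (Matrix.toEuclideanLin A (G x)) :=
    continuous_absVec.comp ((LinearMap.continuous_of_finiteDimensional _).comp hG)
  unfold risk
  fun_prop

/-- No one-sided directional derivative of `f` at `x` is negative: the negation of the descent
property in the theorem. Directions without a derivative impose no condition. -/
def IsStationary {k : ℕ} (f : E k → ℝ) (x : E k) : Prop :=
  ∀ v D, HasOneSidedDeriv f x v D → 0 ≤ D

section Risk

variable {n : ℕ → ℕ} {m d : ℕ} {W : ∀ i, Matrix (Fin (n (i + 1))) (Fin (n i)) ℝ}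
  {A : Matrix (Fin m) (Fin (n d)) ℝ} {ε : ℝ}

theorem hasOneSidedDeriv_risk_smul (x₀ x : E (n 0)) {c σ : ℝ}
    (hσ : ∀ᶠ t in 𝓝[>] (0 : ℝ), 0 ≤ c + t * σ) :
    HasOneSidedDeriv (risk (gen W d) A x₀) (c • x) (σ • x)
      (inner ℝ (c • absVec (Matrix.toEuclideanLin A (gen W d x)) -
        absVec (Matrix.toEuclideanLin A (gen W d x₀)))
        (σ • absVec (Matrix.toEuclideanLin A (gen W d x)))) := by
  refine hasOneSidedDeriv_of_eventually_eq (continuous_risk (continuous_gen W d) A x₀) ?_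
  filter_upwards [hσ] with t ht
  rw [risk, smul_smul, ← add_smul, gen_smul W d x ht, map_smul, absVec_smul, abs_of_nonneg ht,
    add_smul, smul_smul, add_sub_right_comm]

theorem exists_hasOneSidedDeriv_risk_le (hA : RRCP (gen W d) A ε)
    (hG : ∀ y, y ≠ 0 → gen W d y ≠ 0) {x x₀ : E (n 0)} (hx : x ≠ 0) (hx₀ : x₀ ≠ 0)
    (v : E (n 0)) :
    ∃ D, HasOneSidedDeriv (risk (gen W d) A x₀) x v D ∧ ∀ᶠ t in 𝓝[>] (0 : ℝ),
      D ≤ inner ℝ (genLin W (x + t • v) d x) (genLin W (x + t • v) d v) -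
        inner ℝ (Phi (gen W d (x + t • v)) (gen W d x₀) (gen W d x₀)) (genLin W (x + t • v) d v) +
        7 * ε * (‖genLin W (x + t • v) d x‖ + ‖gen W d x₀‖) * ‖genLin W (x + t • v) d v‖ := by
  obtain ⟨L, hLx, hL⟩ := exists_eventually_genLin_eq_and_apply W x v d
  obtain ⟨S, hS⟩ := exists_eventually_signRows_eq A (L x) (L v)
  have hgen {t : ℝ} (ht : genLin W (x + t • v) d = L) : gen W d (x + t • v) = L x + t • L v := by
    rw [← genLin_apply_self, ht, map_add, map_smul]
  refine ⟨inner ℝ (Matrix.toEuclideanLin S (L x) - absVec (Matrix.toEuclideanLin A (gen W d x₀)))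
    (Matrix.toEuclideanLin S (L v)), hasOneSidedDeriv_of_eventually_eq
      (continuous_risk (continuous_gen W d) A x₀) ?_, ?_⟩
  · filter_upwards [hL, hS] with t hLt hSt
    rw [risk, hgen hLt, absVec_eq_signRows, hSt, map_add, map_smul, add_sub_right_comm]
  · filter_upwards [hL, hS, eventually_add_smul_ne_zero v hx, self_mem_nhdsWithin]
      with t hLt hSt hy ht
    have hb : gen W d (x + t • v) - gen W d x = t • L v := by
      rw [hgen hLt, hLx, add_sub_cancel_left]
    have hsign : signRows A (gen W d (x + t • v)) = S := by rw [hgen hLt, hSt]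
    have hself := hA.abs_inner_signRows_sub_le (gen_zero_right W d) hy hy x (mem_Ioi.1 ht) hb
    have hcross := hA.abs_inner_signRows_sub_le (gen_zero_right W d) hy hx₀ x₀ (mem_Ioi.1 ht) hb
    rw [Phi_self (hG _ hy), ContinuousLinearMap.id_apply, hsign, ← hLx] at hself
    rw [hsign, ← absVec_eq_signRows] at hcross
    rw [hLt, inner_sub_left]
    linarith [(abs_le.1 hself).2, (abs_le.1 hcross).1]

theorem exists_hasOneSidedDeriv_risk_zero_neg (hA : RRCP (gen W d) A ε) (hε : 7 * ε < 2 / π)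
    {x x₀ : E (n 0)} (hGx : gen W d x ≠ 0) (hGx₀ : gen W d x₀ ≠ 0) :
    ∃ D < 0, HasOneSidedDeriv (risk (gen W d) A x₀) 0 x D := by
  have hderiv := hasOneSidedDeriv_risk_smul (W := W) (A := A) x₀ x (c := 0) (σ := 1)
    (eventually_mem_nhdsWithin.mono fun t (ht : 0 < t) => by linarith)
  simp only [zero_smul, one_smul, zero_sub, inner_neg_left] at hderiv
  refine ⟨_, neg_lt_zero.2 ?_, hderiv⟩
  have hcorr := (abs_le.1
    (hA.abs_inner_absVec_sub_le (gen_zero_right W d) hGx hGx₀)).1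
  have hfactor := two_div_pi_le_phaseFactor (angle_mem_Icc (gen W d x) (gen W d x₀))
  have hpos : 0 < ‖gen W d x‖ * ‖gen W d x₀‖ :=
    mul_pos (norm_pos_iff.2 hGx) (norm_pos_iff.2 hGx₀)
  linarith [mul_lt_mul_of_pos_right (hε.trans_le hfactor) hpos]

theorem IsStationary.inner_absVec_eq {x₀ x : E (n 0)}
    (hx : IsStationary (risk (gen W d) A x₀) x) :
    inner ℝ (absVec (Matrix.toEuclideanLin A (gen W d x₀)))
        (absVec (Matrix.toEuclideanLin A (gen W d x))) =
      inner ℝ (absVec (Matrix.toEuclideanLin A (gen W d x)))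
        (absVec (Matrix.toEuclideanLin A (gen W d x))) := by
  have hlim (σ : ℝ) : ∀ᶠ t in 𝓝[>] (0 : ℝ), 0 ≤ 1 + t * σ :=
    ((tendsto_add_smul_nhdsGT_zero (1 : ℝ) σ).eventually (lt_mem_nhds one_pos)).mono
      fun t ht => ht.le
  have hout := hx _ _ (by simpa only [one_smul] using
    hasOneSidedDeriv_risk_smul (W := W) (A := A) x₀ x (hlim 1))
  have hin := hx _ _ (by simpa only [one_smul] using
    hasOneSidedDeriv_risk_smul (W := W) (A := A) x₀ x (hlim (-1)))
  simp only [one_smul, neg_smul, inner_neg_right, inner_sub_left] at hout hin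
  linarith

end Risk

/-! ### Consequences of the weight distribution condition -/

theorem abs_mul_mul_sub_le {κ a b x y c : ℝ} (hκ : 0 ≤ κ) (ha : 0 ≤ a) (hb : 0 ≤ b) (hx : 0 ≤ x)
    (hy : 0 ≤ y) (hc₀ : 0 ≤ c) (hc₁ : c ≤ 1) (hax : |κ * a ^ 2 - x ^ 2| ≤ c * x ^ 2)
    (hby : |κ * b ^ 2 - y ^ 2| ≤ c * y ^ 2) : |κ * (a * b) - x * y| ≤ c * (x * y) := by
  rw [abs_le] at hax hby
  have hlower : (1 - c) * (x * y) ≤ κ * (a * b) := by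
    refine (abs_le_of_sq_le_sq' ?_ (by positivity)).2
    calc ((1 - c) * (x * y)) ^ 2 = ((1 - c) * x ^ 2) * ((1 - c) * y ^ 2) := by ring
      _ ≤ (κ * a ^ 2) * (κ * b ^ 2) :=
        mul_le_mul (by linarith) (by linarith)
          (mul_nonneg (sub_nonneg.2 hc₁) (sq_nonneg y)) (by positivity)
      _ = (κ * (a * b)) ^ 2 := by ring
  have hupper : κ * (a * b) ≤ (1 + c) * (x * y) := by
    refine (abs_le_of_sq_le_sq' ?_ (by positivity)).2
    calc (κ * (a * b)) ^ 2 = (κ * a ^ 2) * (κ * b ^ 2) := by ring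
      _ ≤ ((1 + c) * x ^ 2) * ((1 + c) * y ^ 2) :=
        mul_le_mul (by linarith) (by linarith) (by positivity) (by positivity)
      _ = ((1 + c) * (x * y)) ^ 2 := by ring
  rw [abs_le]
  constructor <;> linarith

theorem prod_mul_sub_le_of_mul_sub_le {p a : ℕ → ℝ} {δ : ℝ} {d : ℕ} (hδ : 0 ≤ δ)
    (hp : ∀ i, p i ∈ Icc 0 1) (h : ∀ i < d, p i * a i - δ ≤ a (i + 1)) :
    ∀ i ≤ d, (∏ j ∈ Finset.range i, p j) * a 0 - i * δ ≤ a i := by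
  intro i
  induction i with
  | zero => intro _; simp
  | succ i ih =>
    intro hi
    have hdecay : p i * (i * δ) ≤ i * δ := mul_le_of_le_one_left (by positivity) (hp i).2
    calc (∏ j ∈ Finset.range (i + 1), p j) * a 0 - (i + 1 : ℕ) * δ
        = p i * ((∏ j ∈ Finset.range i, p j) * a 0) - i * δ - δ := by
          rw [Finset.prod_range_succ]
          push_cast
          ring
      _ ≤ p i * ((∏ j ∈ Finset.range i, p j) * a 0 - i * δ) - δ := by linarith
      _ ≤ p i * a i - δ := by
          gcongr
          exacts [(hp i).1, ih (by omega)]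
      _ ≤ a (i + 1) := h i hi

theorem pi_sub_angle_div_pi_mem_Icc {V : Type*} [NormedAddCommGroup V] [InnerProductSpace ℝ V]
    (x y : V) : (π - angle x y) / π ∈ Icc 0 1 :=
  ⟨div_nonneg (sub_nonneg.2 (angle_le_pi x y)) pi_pos.le,
    (div_le_one pi_pos).2 (sub_le_self _ (angle_nonneg x y))⟩

theorem one_div_seven_le_of_cos {θ : ℝ} (hθ : θ ∈ Icc 0 π) (h : 1 / 4 ≤ cos θ) :
    1 / 7 ≤ (π - 2 * θ) / π := by
  have hθ2 : θ ≤ π / 2 := by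
    by_contra! hlt
    linarith [cos_neg_of_pi_div_two_lt_of_lt hlt (by linarith [hθ.2, pi_pos])]
  have hsin : cos θ ≤ π / 2 - θ := by
    rw [← sin_pi_div_two_sub]
    exact sin_le (by linarith)
  rw [div_le_div_iff₀ (by norm_num) pi_pos]
  linarith [pi_lt_d2]

section WDC

variable {n k : ℕ} {W : Matrix (Fin n) (Fin k) ℝ} {ε : ℝ}

theorem WDC.nonneg (h : WDC W ε) {x : E k} (hx : x ≠ 0) : 0 ≤ ε :=
  (norm_nonneg _).trans (h x x hx hx)

theorem WDC.abs_inner_sub_le (h : WDC W ε) {x y : E k} (hx : x ≠ 0) (hy : y ≠ 0) (u v : E k) :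
    |inner ℝ (Matrix.toEuclideanLin (posRows W y) u) (Matrix.toEuclideanLin (posRows W x) v) -
      inner ℝ (Q x y u) v| ≤ ε * (‖u‖ * ‖v‖) := by
  rw [← inner_toEuclideanCLM_transpose_mul, ← inner_sub_left, ← sub_apply, ← mul_assoc]
  refine (abs_real_inner_le_norm _ _).trans ?_
  gcongr
  exact (ContinuousLinearMap.le_opNorm _ _).trans (by gcongr; exact h x y hx hy)

theorem WDC.abs_two_mul_inner_sub_le (h : WDC W ε) {y : E k} (hy : y ≠ 0) (u v : E k) :
    |2 * inner ℝ (Matrix.toEuclideanLin (posRows W y) u) (Matrix.toEuclideanLin (posRows W y) v) -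
      inner ℝ u v| ≤ 2 * ε * (‖u‖ * ‖v‖) := by
  have hwdc := h.abs_inner_sub_le hy hy u v
  rw [inner_Q_self hy] at hwdc
  rw [abs_le] at hwdc ⊢
  constructor <;> linarith

theorem WDC.abs_two_mul_inner_relu_sub_le (h : WDC W ε) {y z : E k} (hy : y ≠ 0) (hz : z ≠ 0)
    (v : E k) :
    |2 * inner ℝ (relu (Matrix.toEuclideanLin W z)) (Matrix.toEuclideanLin (posRows W y) v) -
      ((π - angle y z) / π * inner ℝ z v + sin (angle y z) / π * (‖z‖ / ‖y‖) * inner ℝ y v)| ≤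
      2 * ε * (‖z‖ * ‖v‖) := by
  have hwdc := h.abs_inner_sub_le hy hz z v
  rw [inner_Q_right hy hz, ← relu_eq_posRows] at hwdc
  have hscale : (π - angle y z) / π * inner ℝ z v +
      sin (angle y z) / π * (‖z‖ / ‖y‖) * inner ℝ y v =
      2 * ((π - angle y z) / (2 * π) * inner ℝ z v +
        sin (angle y z) / (2 * π) * (‖z‖ / ‖y‖) * inner ℝ y v) := by
    field_simp
  rw [hscale]
  rw [abs_le] at hwdc ⊢
  constructor <;> linarith

theorem WDC.abs_two_mul_norm_sq_relu_sub_le (h : WDC W ε) {x : E k} (hx : x ≠ 0) :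
    |2 * ‖relu (Matrix.toEuclideanLin W x)‖ ^ 2 - ‖x‖ ^ 2| ≤ 2 * ε * ‖x‖ ^ 2 := by
  simpa only [← relu_eq_posRows, real_inner_self_eq_norm_sq, ← sq] using
    h.abs_two_mul_inner_sub_le hx x x

theorem WDC.relu_ne_zero (h : WDC W ε) (hε : ε < 1 / 2) {x : E k} (hx : x ≠ 0) :
    relu (Matrix.toEuclideanLin W x) ≠ 0 := by
  intro hzero
  have hnorm := (abs_le.1 (h.abs_two_mul_norm_sq_relu_sub_le hx)).1
  rw [hzero, norm_zero] at hnorm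
  have hpos : 0 < ‖x‖ ^ 2 := by positivity
  nlinarith

theorem cosStep_angle_mul_norm_mul_norm {V : Type*} [NormedAddCommGroup V] [InnerProductSpace ℝ V]
    {x : V} (hx : x ≠ 0) (z : V) :
    (π - angle x z) / π * inner ℝ z x + sin (angle x z) / π * (‖z‖ / ‖x‖) * inner ℝ x x =
      cosStep (angle x z) * (‖x‖ * ‖z‖) := by
  have hnorm := norm_ne_zero_iff.2 hx
  rw [real_inner_self_eq_norm_sq, real_inner_comm, ← cos_angle_mul_norm_mul_norm x z, cosStep]
  field_simp

theorem WDC.abs_cos_angle_relu_sub_le (h : WDC W ε) (hε : ε ≤ 1 / 2) {x z : E k} (hx : x ≠ 0)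
    (hz : z ≠ 0) :
    |cos (angle (relu (Matrix.toEuclideanLin W x)) (relu (Matrix.toEuclideanLin W z))) -
      cosStep (angle x z)| ≤ 4 * ε := by
  have hinner := h.abs_two_mul_inner_relu_sub_le hx hz x
  have hprod := abs_mul_mul_sub_le zero_le_two (norm_nonneg _) (norm_nonneg _) (norm_nonneg _)
    (norm_nonneg _) (by linarith [h.nonneg hx]) (by linarith)
    (h.abs_two_mul_norm_sq_relu_sub_le hx) (h.abs_two_mul_norm_sq_relu_sub_le hz)
  rw [cosStep_angle_mul_norm_mul_norm hx, ← relu_eq_posRows, real_inner_comm,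
    ← cos_angle_mul_norm_mul_norm] at hinner
  set X := relu (Matrix.toEuclideanLin W x)
  set Z := relu (Matrix.toEuclideanLin W z)
  set c := cos (angle X Z)
  set s := cosStep (angle x z)
  have hxz : 0 < ‖x‖ * ‖z‖ := mul_pos (norm_pos_iff.2 hx) (norm_pos_iff.2 hz)
  refine le_of_mul_le_mul_right ?_ hxz
  calc |c - s| * (‖x‖ * ‖z‖)
      = |2 * (c * (‖X‖ * ‖Z‖)) - s * (‖x‖ * ‖z‖) - c * (2 * (‖X‖ * ‖Z‖) - ‖x‖ * ‖z‖)| := by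
        rw [← abs_of_pos hxz, ← abs_mul, abs_of_pos hxz]
        ring_nf
    _ ≤ 2 * ε * (‖z‖ * ‖x‖) + 1 * (2 * ε * (‖x‖ * ‖z‖)) := by
        refine (abs_sub _ _).trans (add_le_add hinner ?_)
        rw [abs_mul]
        gcongr
        exact abs_cos_le_one _
    _ = 4 * ε * (‖x‖ * ‖z‖) := by ring

end WDC

section Network

variable {n : ℕ → ℕ} {d : ℕ} {W : ∀ i, Matrix (Fin (n (i + 1))) (Fin (n i)) ℝ} {ε : ℝ}

theorem gen_ne_zero (hW : ∀ i < d, WDC (W i) ε) (hε : ε < 1 / 2) {x : E (n 0)} (hx : x ≠ 0) :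
    ∀ i ≤ d, gen W i x ≠ 0 := by
  intro i
  induction i with
  | zero => exact fun _ => hx
  | succ i ih => exact fun hi => (hW i hi).relu_ne_zero hε (ih (by omega))

theorem abs_cos_angle_gen_succ_sub_le (hW : ∀ i < d, WDC (W i) ε) (hε : ε < 1 / 2)
    {y z : E (n 0)} (hy : y ≠ 0) (hz : z ≠ 0) :
    ∀ i < d, |cos (angle (gen W (i + 1) y) (gen W (i + 1) z)) -
      cosStep (angle (gen W i y) (gen W i z))| ≤ 4 * ε := fun i hi =>
  (hW i hi).abs_cos_angle_relu_sub_le hε.le (gen_ne_zero hW hε hy i hi.le)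
    (gen_ne_zero hW hε hz i hi.le)

theorem cosStep_sub_le_cos_angle_gen_succ (hW : ∀ i < d, WDC (W i) ε) (hε : ε < 1 / 2)
    {y z : E (n 0)} (hy : y ≠ 0) (hz : z ≠ 0) :
    ∀ i < d, cosStep (angle (gen W i y) (gen W i z)) - 4 * ε ≤
      cos (angle (gen W (i + 1) y) (gen W (i + 1) z)) := fun i hi => by
  linarith [(abs_le.1 (abs_cos_angle_gen_succ_sub_le hW hε hy hz i hi)).1]

theorem one_div_seven_le_pi_sub_two_mul_angle_gen (hW : ∀ i < d, WDC (W i) ε)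
    (hε : 200 * ε ≤ 1) (hd : 2 ≤ d) {y z : E (n 0)} (hy : y ≠ 0) (hz : z ≠ 0) :
    1 / 7 ≤ (π - 2 * angle (gen W d y) (gen W d z)) / π := by
  obtain ⟨i, rfl⟩ := Nat.exists_eq_add_of_le' hd
  have hstep := cosStep_sub_le_cos_angle_gen_succ hW (by linarith) hy hz
  have hε₀ : 0 ≤ ε := (hW 0 (by omega)).nonneg hy
  have hπ : 7 / 22 < 1 / π := by
    rw [div_lt_div_iff₀ (by norm_num) pi_pos]
    linarith [pi_lt_d4]
  have hpred : -(4 * ε) ≤ cos (angle (gen W (i + 1) y) (gen W (i + 1) z)) := by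
    linarith [hstep i (by omega), (cosStep_mem_Icc (angle_mem_Icc (gen W i y) (gen W i z))).1]
  refine one_div_seven_le_of_cos (angle_mem_Icc _ _) ?_
  linarith [hstep (i + 1) (by omega),
    one_div_pi_sub_le_cosStep (angle_mem_Icc _ _) (by linarith) hpred]

theorem abs_two_pow_mul_inner_genLin_sub_le (hW : ∀ i < d, WDC (W i) ε) (hε : 0 ≤ ε)
    (hd : 8 * (d * ε) ≤ 1) {y : E (n 0)} (hy : y ≠ 0) :
    ∀ i ≤ d, ∀ u v, |2 ^ i * inner ℝ (genLin W y i u) (genLin W y i v) - inner ℝ u v| ≤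
      4 * (i * ε) * (‖u‖ * ‖v‖) := by
  intro i
  induction i with
  | zero => intro _ u v; simp [genLin]
  | succ i ih =>
    intro hi u v
    have hdε : (i + 1 : ℕ) * ε ≤ d * ε := by gcongr
    push_cast at hdε
    have hiε : 0 ≤ i * ε := by positivity
    have hlayer := (hW i hi).abs_two_mul_inner_sub_le
      (gen_ne_zero hW (by linarith) hy i (by omega)) (genLin W y i u) (genLin W y i v)
    have hsq (w : E (n 0)) : |2 ^ i * ‖genLin W y i w‖ ^ 2 - ‖w‖ ^ 2| ≤ 4 * (i * ε) * ‖w‖ ^ 2 := by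
      simpa only [real_inner_self_eq_norm_sq, ← sq] using ih (by omega) w w
    have hnorm : 2 ^ i * (‖genLin W y i u‖ * ‖genLin W y i v‖) ≤ 2 * (‖u‖ * ‖v‖) := by
      have hprod := abs_mul_mul_sub_le (by positivity) (norm_nonneg _) (norm_nonneg _)
        (norm_nonneg _) (norm_nonneg _) (by positivity) (by linarith) (hsq u) (hsq v)
      nlinarith [(abs_le.1 hprod).2, mul_nonneg (norm_nonneg u) (norm_nonneg v)]
    rw [← genLin_succ_apply, ← genLin_succ_apply] at hlayer
    calc |2 ^ (i + 1) * inner ℝ (genLin W y (i + 1) u) (genLin W y (i + 1) v) - inner ℝ u v|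
        = |2 ^ i * (2 * inner ℝ (genLin W y (i + 1) u) (genLin W y (i + 1) v) -
            inner ℝ (genLin W y i u) (genLin W y i v)) +
            (2 ^ i * inner ℝ (genLin W y i u) (genLin W y i v) - inner ℝ u v)| := by ring_nf
      _ ≤ 2 ^ i * (2 * ε * (‖genLin W y i u‖ * ‖genLin W y i v‖)) +
            4 * (i * ε) * (‖u‖ * ‖v‖) := by
          refine (abs_add_le _ _).trans (add_le_add ?_ (ih (by omega) u v))
          rw [abs_mul, abs_of_pos (by positivity)]
          gcongr
      _ = 2 * ε * (2 ^ i * (‖genLin W y i u‖ * ‖genLin W y i v‖)) +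
            4 * (i * ε) * (‖u‖ * ‖v‖) := by ring
      _ ≤ 2 * ε * (2 * (‖u‖ * ‖v‖)) + 4 * (i * ε) * (‖u‖ * ‖v‖) := by gcongr
      _ = 4 * ((i + 1 : ℕ) * ε) * (‖u‖ * ‖v‖) := by push_cast; ring

theorem abs_two_pow_mul_norm_genLin_sq_sub_le (hW : ∀ i < d, WDC (W i) ε) (hε : 0 ≤ ε)
    (hd : 8 * (d * ε) ≤ 1) {y : E (n 0)} (hy : y ≠ 0) {i : ℕ} (hi : i ≤ d) (u : E (n 0)) :
    |2 ^ i * ‖genLin W y i u‖ ^ 2 - ‖u‖ ^ 2| ≤ 4 * (d * ε) * ‖u‖ ^ 2 := by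
  have hinner := abs_two_pow_mul_inner_genLin_sub_le hW hε hd hy i hi u u
  rw [real_inner_self_eq_norm_sq, real_inner_self_eq_norm_sq, ← sq] at hinner
  exact hinner.trans (by gcongr)

theorem abs_two_pow_mul_norm_genLin_mul_sub_le (hW : ∀ i < d, WDC (W i) ε) (hε : 0 ≤ ε)
    (hd : 8 * (d * ε) ≤ 1) {y z : E (n 0)} (hy : y ≠ 0) (hz : z ≠ 0) {i : ℕ} (hi : i ≤ d)
    (u v : E (n 0)) :
    |2 ^ i * (‖genLin W y i u‖ * ‖genLin W z i v‖) - ‖u‖ * ‖v‖| ≤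
      4 * (d * ε) * (‖u‖ * ‖v‖) :=
  abs_mul_mul_sub_le (by positivity) (norm_nonneg _) (norm_nonneg _) (norm_nonneg _)
    (norm_nonneg _) (by positivity) (by linarith)
    (abs_two_pow_mul_norm_genLin_sq_sub_le hW hε hd hy hi u)
    (abs_two_pow_mul_norm_genLin_sq_sub_le hW hε hd hz hi v)

theorem two_pow_mul_norm_genLin_mul_le (hW : ∀ i < d, WDC (W i) ε) (hε : 0 ≤ ε)
    (hd : 8 * (d * ε) ≤ 1) {y z : E (n 0)} (hy : y ≠ 0) (hz : z ≠ 0) {i : ℕ} (hi : i ≤ d)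
    (u v : E (n 0)) :
    2 ^ i * (‖genLin W y i u‖ * ‖genLin W z i v‖) ≤ 2 * (‖u‖ * ‖v‖) := by
  have hprod := (abs_le.1 (abs_two_pow_mul_norm_genLin_mul_sub_le hW hε hd hy hz hi u v)).2
  nlinarith [mul_nonneg (norm_nonneg u) (norm_nonneg v)]

theorem norm_gen_div_norm_gen_mul_norm_le (hW : ∀ i < d, WDC (W i) ε) (hε : 0 ≤ ε)
    (hd : 8 * (d * ε) ≤ 1) {y z : E (n 0)} (hy : y ≠ 0) (hz : z ≠ 0) {i : ℕ} (hi : i ≤ d) :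
    ‖gen W i z‖ / ‖gen W i y‖ * ‖y‖ ≤ 2 * ‖z‖ := by
  have hupper : 2 ^ i * ‖gen W i z‖ ^ 2 ≤ 2 * ‖z‖ ^ 2 := by
    simpa only [genLin_apply_self, ← sq] using
      two_pow_mul_norm_genLin_mul_le hW hε hd hz hz hi z z
  have hlower : ‖y‖ ^ 2 ≤ 2 * (2 ^ i * ‖gen W i y‖ ^ 2) := by
    have hy2 := (abs_le.1 (abs_two_pow_mul_norm_genLin_sq_sub_le hW hε hd hy hi y)).1
    rw [genLin_apply_self] at hy2
    nlinarith [sq_nonneg ‖y‖]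
  rw [div_mul_eq_mul_div]
  refine div_le_of_le_mul₀ (norm_nonneg _) (by positivity) ?_
  refine le_of_mul_le_mul_left ?_ (show (0 : ℝ) < 2 ^ i by positivity)
  refine (abs_le_of_sq_le_sq' ?_ (by positivity)).2
  calc (2 ^ i * (‖gen W i z‖ * ‖y‖)) ^ 2
      = 2 ^ i * (2 ^ i * ‖gen W i z‖ ^ 2 * ‖y‖ ^ 2) := by ring
    _ ≤ 2 ^ i * (2 * ‖z‖ ^ 2 * (2 * (2 ^ i * ‖gen W i y‖ ^ 2))) := by
        refine mul_le_mul_of_nonneg_left ?_ (by positivity)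
        exact mul_le_mul hupper hlower (by positivity) (by positivity)
    _ = (2 ^ i * (2 * ‖z‖ * ‖gen W i y‖)) ^ 2 := by ring

theorem neg_le_mul_inner_gen_genLin (hW : ∀ i < d, WDC (W i) ε) (hε : 0 ≤ ε)
    (hd : 8 * (d * ε) ≤ 1) {y z e : E (n 0)} (hy : y ≠ 0) (hz : z ≠ 0) (he : 0 ≤ inner ℝ y e)
    {i : ℕ} (hi : i ≤ d) {κ : ℝ} (hκ : κ ∈ Icc 0 1) :
    -(8 * (i * ε) * (‖z‖ * ‖e‖)) ≤
      2 ^ i * (κ * (‖gen W i z‖ / ‖gen W i y‖) * inner ℝ (gen W i y) (genLin W y i e)) := by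
  have hinner := (abs_le.1 (abs_two_pow_mul_inner_genLin_sub_le hW hε hd hy i hi y e)).1
  have hratio := norm_gen_div_norm_gen_mul_norm_le hW hε hd hy hz hi
  rw [genLin_apply_self] at hinner
  set r := ‖gen W i z‖ / ‖gen W i y‖
  have hr : 0 ≤ r := by positivity
  have hκr : 0 ≤ κ * r := mul_nonneg hκ.1 hr
  have hκry : κ * (r * ‖y‖) ≤ 2 * ‖z‖ := (mul_le_of_le_one_left (by positivity) hκ.2).trans hratio
  calc -(8 * (i * ε) * (‖z‖ * ‖e‖)) = -(4 * (i * ε) * ‖e‖ * (2 * ‖z‖)) := by ring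
    _ ≤ -(4 * (i * ε) * ‖e‖ * (κ * (r * ‖y‖))) := by gcongr
    _ = κ * r * -(4 * (i * ε) * (‖y‖ * ‖e‖)) := by ring
    _ ≤ κ * r * (2 ^ i * inner ℝ (gen W i y) (genLin W y i e)) := by
        gcongr
        linarith
    _ = 2 ^ i * (κ * r * inner ℝ (gen W i y) (genLin W y i e)) := by ring

theorem sin_angle_div_pi_mem_Icc {V : Type*} [NormedAddCommGroup V] [InnerProductSpace ℝ V]
    (x y : V) : sin (angle x y) / π ∈ Icc 0 1 :=
  ⟨div_nonneg (sin_angle_nonneg x y) pi_pos.le,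
    (div_le_one pi_pos).2 ((sin_le_one _).trans (by linarith [pi_gt_three]))⟩

theorem mul_inner_gen_genLin_sub_le_succ (hW : ∀ i < d, WDC (W i) ε) (hε : 0 ≤ ε)
    (hd : 8 * (d * ε) ≤ 1) {y z e : E (n 0)} (hy : y ≠ 0) (hz : z ≠ 0) (he : 0 ≤ inner ℝ y e)
    {i : ℕ} (hi : i < d) :
    (π - angle (gen W i y) (gen W i z)) / π * (2 ^ i * inner ℝ (gen W i z) (genLin W y i e)) -
        8 * (d * ε) * (‖z‖ * ‖e‖) ≤
      2 ^ (i + 1) * inner ℝ (gen W (i + 1) z) (genLin W y (i + 1) e) := by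
  have hdε : (i + 1 : ℕ) * ε ≤ d * ε := by gcongr; exact hi
  push_cast at hdε
  have hiε : 0 ≤ i * ε := by positivity
  have hlayer := (abs_le.1 ((hW i hi).abs_two_mul_inner_relu_sub_le
    (gen_ne_zero hW (by linarith) hy i hi.le) (gen_ne_zero hW (by linarith) hz i hi.le)
    (genLin W y i e))).1
  have hcross := neg_le_mul_inner_gen_genLin hW hε hd hy hz he hi.le
    (sin_angle_div_pi_mem_Icc (gen W i y) (gen W i z))
  have hnorm := two_pow_mul_norm_genLin_mul_le hW hε hd hz hy hi.le z e
  rw [genLin_apply_self] at hnorm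
  rw [← genLin_succ_apply] at hlayer
  change _ ≤ 2 * inner ℝ (gen W (i + 1) z) _ - _ at hlayer
  have hscaled := mul_le_mul_of_nonneg_left hlayer (show (0 : ℝ) ≤ 2 ^ i by positivity)
  have hnormε := mul_le_mul_of_nonneg_left hnorm hε
  have hdε' := mul_le_mul_of_nonneg_right hdε (show 0 ≤ ‖z‖ * ‖e‖ by positivity)
  have hnonneg : 0 ≤ ε * (‖z‖ * ‖e‖) := by positivity
  rw [pow_succ]
  linarith

theorem prod_mul_inner_sub_le_inner_gen_genLin (hW : ∀ i < d, WDC (W i) ε) (hε : 0 ≤ ε)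
    (hd : 8 * (d * ε) ≤ 1) {y z e : E (n 0)} (hy : y ≠ 0) (hz : z ≠ 0)
    (he : 0 ≤ inner ℝ y e) :
    (∏ i ∈ Finset.range d, (π - angle (gen W i y) (gen W i z)) / π) * inner ℝ z e -
        8 * (d ^ 2 * ε) * (‖z‖ * ‖e‖) ≤
      2 ^ d * inner ℝ (gen W d z) (genLin W y d e) := by
  have hprod := prod_mul_sub_le_of_mul_sub_le
    (a := fun i => 2 ^ i * inner ℝ (gen W i z) (genLin W y i e)) (by positivity)
    (fun i => pi_sub_angle_div_pi_mem_Icc (gen W i y) (gen W i z))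
    (fun i hi => mul_inner_gen_genLin_sub_le_succ hW hε hd hy hz he hi) d le_rfl
  simp only [pow_zero, one_mul] at hprod
  refine le_trans (le_of_eq ?_) hprod
  rw [gen, genLin, LinearMap.id_apply]
  ring

end Network

/-! ### Stationary points -/

theorem exists_inner_eq_zero_and_norm_eq_norm_mul_sin_angle {V : Type*} [NormedAddCommGroup V]
    [InnerProductSpace ℝ V] {x : V} (hx : x ≠ 0) (z : V) :
    ∃ e, inner ℝ x e = 0 ∧ inner ℝ z e = ‖e‖ ^ 2 ∧ ‖e‖ = ‖z‖ * sin (angle x z) := by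
  have hnorm := norm_ne_zero_iff.2 hx
  have hx_inner : inner ℝ x (z - (inner ℝ x z / ‖x‖ ^ 2) • x) = 0 := by
    rw [inner_sub_right, real_inner_smul_right, real_inner_self_eq_norm_sq]
    field_simp
    ring
  have hz_inner : inner ℝ z (z - (inner ℝ x z / ‖x‖ ^ 2) • x) =
      ‖z - (inner ℝ x z / ‖x‖ ^ 2) • x‖ ^ 2 := by
    rw [← real_inner_self_eq_norm_sq (z - _), inner_sub_left (z := z - _), real_inner_smul_left,
      hx_inner, mul_zero, sub_zero]
  refine ⟨_, hx_inner, hz_inner, ?_⟩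
  refine (sq_eq_sq₀ (norm_nonneg _) (mul_nonneg (norm_nonneg _) (sin_angle_nonneg _ _))).1 ?_
  rw [← hz_inner, inner_sub_right, real_inner_smul_right, real_inner_self_eq_norm_sq,
    real_inner_comm, ← cos_angle_mul_norm_mul_norm, mul_pow, sin_sq,
    angle_comm z x]
  field_simp

theorem norm_sub_smul_le {V : Type*} [NormedAddCommGroup V] [InnerProductSpace ℝ V] (x z : V)
    (c : ℝ) :
    ‖x - c • z‖ ≤ |‖x‖ - c * (‖z‖ * cos (angle x z))| + |c| * (‖z‖ * sin (angle x z)) := by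
  have hperp : 0 ≤ |c| * (‖z‖ * sin (angle x z)) :=
    mul_nonneg (abs_nonneg c) (mul_nonneg (norm_nonneg z) (sin_angle_nonneg x z))
  have hpythagoras : ‖x - c • z‖ ^ 2 =
      |‖x‖ - c * (‖z‖ * cos (angle x z))| ^ 2 + (|c| * (‖z‖ * sin (angle x z))) ^ 2 := by
    rw [norm_sub_sq_real, real_inner_smul_right, ← cos_angle_mul_norm_mul_norm, norm_smul,
      norm_eq_abs]
    simp only [mul_pow, sq_abs, sin_sq]
    ring
  refine (abs_le_of_sq_le_sq' ?_ (by positivity)).2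
  rw [hpythagoras]
  nlinarith [mul_nonneg (abs_nonneg (‖x‖ - c * (‖z‖ * cos (angle x z)))) hperp]

section Stationary

variable {n : ℕ → ℕ} {m d : ℕ} {W : ∀ i, Matrix (Fin (n (i + 1))) (Fin (n i)) ℝ}
  {A : Matrix (Fin m) (Fin (n d)) ℝ} {ε : ℝ} {x x₀ : E (n 0)}

theorem IsStationary.abs_norm_gen_sq_sub_le (h : IsStationary (risk (gen W d) A x₀) x)
    (hA : RRCP (gen W d) A ε) (hGx : gen W d x ≠ 0) (hGx₀ : gen W d x₀ ≠ 0) :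
    |‖gen W d x‖ ^ 2 - phaseFactor (angle (gen W d x) (gen W d x₀)) *
      (‖gen W d x‖ * ‖gen W d x₀‖)| ≤
      7 * ε * (‖gen W d x‖ * ‖gen W d x‖ + ‖gen W d x‖ * ‖gen W d x₀‖) := by
  have hcross := hA.abs_inner_absVec_sub_le (gen_zero_right W d) hGx hGx₀
  have hself := hA.abs_inner_absVec_sub_le (gen_zero_right W d) hGx hGx
  rw [angle_self hGx, phaseFactor_zero, one_mul, ← h.inner_absVec_eq] at hself
  rw [abs_le] at hcross hself ⊢
  constructor <;> linarith

theorem IsStationary.abs_norm_sub_phaseFactor_mul_norm_le_mul_add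
    (h : IsStationary (risk (gen W d) A x₀) x) (hW : ∀ i < d, WDC (W i) ε)
    (hA : RRCP (gen W d) A ε) (hε : 0 ≤ ε) (hd : 1 ≤ d) (hdε : 8 * (d * ε) ≤ 1) (hx : x ≠ 0)
    (hx₀ : x₀ ≠ 0) :
    |‖x‖ - phaseFactor (angle (gen W d x) (gen W d x₀)) * ‖x₀‖| ≤
      d * ε * (18 * ‖x‖ + 22 * ‖x₀‖) := by
  have hεd : ε ≤ d * ε := le_mul_of_one_le_left hε (by exact_mod_cast hd)
  have hGx := gen_ne_zero hW (by linarith) hx d le_rfl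
  have hGx₀ := gen_ne_zero hW (by linarith) hx₀ d le_rfl
  have hgen := h.abs_norm_gen_sq_sub_le hA hGx hGx₀
  have hself := abs_two_pow_mul_norm_genLin_mul_sub_le hW hε hdε hx hx le_rfl x x
  have hcross := abs_two_pow_mul_norm_genLin_mul_sub_le hW hε hdε hx hx₀ le_rfl x x₀
  have hself' := two_pow_mul_norm_genLin_mul_le hW hε hdε hx hx le_rfl x x
  have hcross' := two_pow_mul_norm_genLin_mul_le hW hε hdε hx hx₀ le_rfl x x₀
  simp only [genLin_apply_self] at hself hcross hself' hcross'
  have hF₀ : 0 ≤ phaseFactor (angle (gen W d x) (gen W d x₀)) :=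
    le_trans (by positivity) (two_div_pi_le_phaseFactor (angle_mem_Icc _ _))
  have hF₂ := phaseFactor_le_two (angle_mem_Icc (gen W d x) (gen W d x₀))
  set F := phaseFactor (angle (gen W d x) (gen W d x₀))
  set X := ‖gen W d x‖
  set Z := ‖gen W d x₀‖
  have hxn : 0 < ‖x‖ := norm_pos_iff.2 hx
  refine le_of_mul_le_mul_left ?_ hxn
  calc ‖x‖ * |‖x‖ - F * ‖x₀‖|
      = |2 ^ d * (X ^ 2 - F * (X * Z)) - (2 ^ d * (X * X) - ‖x‖ * ‖x‖) +
          F * (2 ^ d * (X * Z) - ‖x‖ * ‖x₀‖)| := by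
        rw [← abs_of_pos hxn, ← abs_mul, abs_of_pos hxn]
        ring_nf
    _ ≤ 2 ^ d * (7 * ε * (X * X + X * Z)) + 4 * (d * ε) * (‖x‖ * ‖x‖) +
          2 * (4 * (d * ε) * (‖x‖ * ‖x₀‖)) := by
        refine (abs_add_le _ _).trans (add_le_add ((abs_sub _ _).trans (add_le_add ?_ hself)) ?_)
        · rw [abs_mul, abs_of_pos (by positivity)]
          gcongr
        · rw [abs_mul, abs_of_nonneg hF₀]
          gcongr
    _ = 7 * ε * (2 ^ d * (X * X) + 2 ^ d * (X * Z)) + 4 * (d * ε) * (‖x‖ * ‖x‖) +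
          2 * (4 * (d * ε) * (‖x‖ * ‖x₀‖)) := by ring
    _ ≤ 7 * (d * ε) * (2 * (‖x‖ * ‖x‖) + 2 * (‖x‖ * ‖x₀‖)) + 4 * (d * ε) * (‖x‖ * ‖x‖) +
          2 * (4 * (d * ε) * (‖x‖ * ‖x₀‖)) := by gcongr
    _ = ‖x‖ * (d * ε * (18 * ‖x‖ + 22 * ‖x₀‖)) := by ring

theorem IsStationary.abs_norm_sub_phaseFactor_mul_norm_le
    (h : IsStationary (risk (gen W d) A x₀) x) (hW : ∀ i < d, WDC (W i) ε)
    (hA : RRCP (gen W d) A ε) (hε : 0 ≤ ε) (hd : 1 ≤ d) (hdε : 100 * (d * ε) ≤ 1) (hx : x ≠ 0)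
    (hx₀ : x₀ ≠ 0) :
    |‖x‖ - phaseFactor (angle (gen W d x) (gen W d x₀)) * ‖x₀‖| ≤ 76 * (d * ε) * ‖x₀‖ := by
  have hnorm := h.abs_norm_sub_phaseFactor_mul_norm_le_mul_add hW hA hε hd (by linarith) hx hx₀
  have hF := mul_le_mul_of_nonneg_right
    (phaseFactor_le_two (angle_mem_Icc (gen W d x) (gen W d x₀))) (norm_nonneg x₀)
  have hx_le : ‖x‖ ≤ 3 * ‖x₀‖ := by
    nlinarith [(abs_le.1 hnorm).2, norm_nonneg x, norm_nonneg x₀]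
  calc _ ≤ d * ε * (18 * ‖x‖ + 22 * ‖x₀‖) := hnorm
    _ ≤ d * ε * (18 * (3 * ‖x₀‖) + 22 * ‖x₀‖) := by gcongr
    _ = 76 * (d * ε) * ‖x₀‖ := by ring

theorem IsStationary.norm_le (h : IsStationary (risk (gen W d) A x₀) x)
    (hW : ∀ i < d, WDC (W i) ε) (hA : RRCP (gen W d) A ε) (hε : 0 ≤ ε) (hd : 1 ≤ d)
    (hdε : 100 * (d * ε) ≤ 1) (hx : x ≠ 0) (hx₀ : x₀ ≠ 0) : ‖x‖ ≤ 3 * ‖x₀‖ := by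
  have hnorm := (abs_le.1 (h.abs_norm_sub_phaseFactor_mul_norm_le hW hA hε hd hdε hx hx₀)).2
  have hF := phaseFactor_le_two (angle_mem_Icc (gen W d x) (gen W d x₀))
  nlinarith [norm_nonneg x₀]

theorem prod_mul_inner_sub_le_inner_Phi_genLin (hW : ∀ i < d, WDC (W i) ε) (hε : 0 ≤ ε)
    (hdε : 8 * (d * ε) ≤ 1) (hd : 1 ≤ d) {y z e : E (n 0)} (hy : y ≠ 0) (hz : z ≠ 0)
    (hangle : 0 ≤ (π - 2 * angle (gen W d y) (gen W d z)) / π) (he : 0 ≤ inner ℝ y e) :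
    (π - 2 * angle (gen W d y) (gen W d z)) / π *
        ((∏ i ∈ Finset.range d, (π - angle (gen W i y) (gen W i z)) / π) * inner ℝ z e) -
        16 * (d ^ 2 * ε) * (‖z‖ * ‖e‖) ≤
      2 ^ d * inner ℝ (Phi (gen W d y) (gen W d z) (gen W d z)) (genLin W y d e) := by
  have hd₁ : (1 : ℝ) ≤ d := by exact_mod_cast hd
  have hεd : ε ≤ d * ε := le_mul_of_one_le_left hε hd₁
  have hangle₁ : (π - 2 * angle (gen W d y) (gen W d z)) / π ≤ 1 :=
    (div_le_one pi_pos).2 (by linarith [angle_nonneg (gen W d y) (gen W d z)])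
  have hsin : 2 * sin (angle (gen W d y) (gen W d z)) / π ∈ Icc 0 1 :=
    ⟨div_nonneg (mul_nonneg zero_le_two (sin_angle_nonneg _ _)) pi_pos.le,
      (div_le_one pi_pos).2
        (by linarith [sin_le_one (angle (gen W d y) (gen W d z)), pi_gt_three])⟩
  have hmain := mul_le_mul_of_nonneg_left
    (prod_mul_inner_sub_le_inner_gen_genLin hW hε hdε hy hz he) hangle
  have hcross := neg_le_mul_inner_gen_genLin hW hε hdε hy hz he le_rfl hsin
  have herror : (π - 2 * angle (gen W d y) (gen W d z)) / π * (8 * (d ^ 2 * ε) * (‖z‖ * ‖e‖)) ≤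
      8 * (d ^ 2 * ε) * (‖z‖ * ‖e‖) := mul_le_of_le_one_left (by positivity) hangle₁
  have hlinear : d * ε * (‖z‖ * ‖e‖) ≤ d ^ 2 * ε * (‖z‖ * ‖e‖) := by
    gcongr
    exact le_self_pow₀ hd₁ two_ne_zero
  rw [inner_Phi_right (gen_ne_zero hW (by linarith) hy d le_rfl)
    (gen_ne_zero hW (by linarith) hz d le_rfl)]
  linarith

theorem le_prod_pi_sub_angle_gen (hW : ∀ i < d, WDC (W i) ε) (hε : 0 ≤ ε) (hε₂ : ε < 1 / 2)
    (hd : 1 ≤ d) (hdε : 4 * ε * (d + 12) ^ 3 ≤ 288) {y z : E (n 0)} (hy : y ≠ 0) (hz : z ≠ 0) :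
    (π - angle y z) / π * (1 / d ^ 12) ≤
      ∏ i ∈ Finset.range d, (π - angle (gen W i y) (gen W i z)) / π :=
  le_prod_pi_sub_div_pi (fun _ => angle_mem_Icc _ _) hd fun i hi =>
    sin_half_le_of_cosStep_le (fun _ => angle_mem_Icc _ _) (by positivity) hdε
      (cosStep_sub_le_cos_angle_gen_succ hW hε₂ hy hz) i hi.le

theorem hundred_mul_le_one_of_pow_three (hε : 0 ≤ ε) (hd : 2 ≤ d)
    (hdε : 10 ^ 4 * d ^ 3 * ε ≤ 1) : 100 * (d * ε) ≤ 1 := by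
  have hd₂ : (2 : ℝ) ≤ d := by exact_mod_cast hd
  have hlinear : (d : ℝ) * ε ≤ d ^ 3 * ε := by
    gcongr
    exact le_self_pow₀ (by linarith) three_ne_zero
  linarith [show 0 ≤ d * ε by positivity]

theorem IsStationary.eventually_inner_Phi_le
    (h : IsStationary (risk (gen W d) A x₀) x) (hW : ∀ i < d, WDC (W i) ε)
    (hA : RRCP (gen W d) A ε) (hε : 0 ≤ ε) (hd : 2 ≤ d) (hdε : 100 * (d * ε) ≤ 1) (hx : x ≠ 0)
    (hx₀ : x₀ ≠ 0) {e : E (n 0)} (hxe : inner ℝ x e = 0) :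
    ∀ᶠ t in 𝓝[>] (0 : ℝ),
      2 ^ d * inner ℝ (Phi (gen W d (x + t • e)) (gen W d x₀) (gen W d x₀))
        (genLin W (x + t • e) d e) ≤ 20 * (d ^ 2 * ε) * (‖x₀‖ * ‖e‖) := by
  have hd₂ : (2 : ℝ) ≤ d := by exact_mod_cast hd
  have hG (y : E (n 0)) (hy : y ≠ 0) : gen W d y ≠ 0 :=
    gen_ne_zero hW (by linarith [mul_le_mul_of_nonneg_right hd₂ hε]) hy d le_rfl
  obtain ⟨D, hD, hbound⟩ := exists_hasOneSidedDeriv_risk_le hA hG hx hx₀ e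
  filter_upwards [hbound, eventually_add_smul_ne_zero e hx] with t htD hy
  have horth := (abs_le.1
    (abs_two_pow_mul_inner_genLin_sub_le hW hε (by linarith) hy d le_rfl x e)).2
  have hnorm := two_pow_mul_norm_genLin_mul_le hW hε (by linarith) hy hy le_rfl x e
  have hnorm₀ := two_pow_mul_norm_genLin_mul_le hW hε (by linarith) hx₀ hy le_rfl x₀ e
  rw [genLin_apply_self] at hnorm₀
  rw [hxe] at horth
  set y := x + t • e
  have hscaled := mul_le_mul_of_nonneg_left ((h e D hD).trans htD)
    (show (0 : ℝ) ≤ 2 ^ d by positivity)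
  have hx_le := h.norm_le hW hA hε (by omega) hdε hx hx₀
  have hnormε := mul_le_mul_of_nonneg_left (add_le_add hnorm hnorm₀)
    (show 0 ≤ 7 * ε by positivity)
  have herror : 4 * (d * ε) * (‖x‖ * ‖e‖) + 7 * ε * (2 * (‖x‖ * ‖e‖) + 2 * (‖x₀‖ * ‖e‖)) ≤
      20 * (d ^ 2 * ε) * (‖x₀‖ * ‖e‖) := by
    calc _ ≤ 4 * (d * ε) * (3 * ‖x₀‖ * ‖e‖) +
          7 * ε * (2 * (3 * ‖x₀‖ * ‖e‖) + 2 * (‖x₀‖ * ‖e‖)) := by gcongr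
      _ = (12 * d + 56) * ε * (‖x₀‖ * ‖e‖) := by ring
      _ ≤ 20 * d ^ 2 * ε * (‖x₀‖ * ‖e‖) := by
        gcongr
        nlinarith
      _ = _ := by ring
  linarith

theorem IsStationary.eventually_mul_prod_mul_norm_sq_le
    (h : IsStationary (risk (gen W d) A x₀) x) (hW : ∀ i < d, WDC (W i) ε)
    (hA : RRCP (gen W d) A ε) (hε : 0 ≤ ε) (hd : 2 ≤ d) (hdε : 100 * (d * ε) ≤ 1) (hx : x ≠ 0)
    (hx₀ : x₀ ≠ 0) {e : E (n 0)} (hxe : inner ℝ x e = 0) (hx₀e : inner ℝ x₀ e = ‖e‖ ^ 2) :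
    ∀ᶠ t in 𝓝[>] (0 : ℝ),
      (π - 2 * angle (gen W d (x + t • e)) (gen W d x₀)) / π *
        ((∏ i ∈ Finset.range d, (π - angle (gen W i (x + t • e)) (gen W i x₀)) / π) *
          ‖e‖ ^ 2) ≤ 36 * (d ^ 2 * ε) * (‖x₀‖ * ‖e‖) := by
  have hd₂ : (2 : ℝ) ≤ d := by exact_mod_cast hd
  filter_upwards [h.eventually_inner_Phi_le hW hA hε hd hdε hx hx₀ hxe,
    eventually_add_smul_ne_zero e hx, self_mem_nhdsWithin] with t hPhi_le hy ht
  have hye : 0 ≤ inner ℝ (x + t • e) e := by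
    rw [inner_add_left, hxe, real_inner_smul_left, zero_add]
    exact mul_nonneg (le_of_lt ht) real_inner_self_nonneg
  have hangle := one_div_seven_le_pi_sub_two_mul_angle_gen hW
    (by linarith [mul_le_mul_of_nonneg_right hd₂ hε]) hd hy hx₀
  have hle_Phi := prod_mul_inner_sub_le_inner_Phi_genLin hW hε (by linarith) (by omega) hy hx₀
    (by linarith) hye
  rw [hx₀e] at hle_Phi
  linarith

theorem IsStationary.eventually_pi_sub_angle_mul_norm_sq_le
    (h : IsStationary (risk (gen W d) A x₀) x) (hW : ∀ i < d, WDC (W i) ε)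
    (hA : RRCP (gen W d) A ε) (hε : 0 ≤ ε) (hd : 2 ≤ d) (hdε : 10 ^ 4 * d ^ 3 * ε ≤ 1)
    (hx : x ≠ 0) (hx₀ : x₀ ≠ 0) {e : E (n 0)} (hxe : inner ℝ x e = 0)
    (hx₀e : inner ℝ x₀ e = ‖e‖ ^ 2) :
    ∀ᶠ t in 𝓝[>] (0 : ℝ),
      (π - angle (x + t • e) x₀) / π * ‖e‖ ^ 2 ≤ 252 * (d ^ 14 * ε) * (‖x₀‖ * ‖e‖) := by
  have hd₂ : (2 : ℝ) ≤ d := by exact_mod_cast hd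
  have hdε₁ := hundred_mul_le_one_of_pow_three hε hd hdε
  have hεd : 2 * ε ≤ d * ε := by gcongr
  have hcube : 4 * ε * (d + 12) ^ 3 ≤ 288 := by
    calc 4 * ε * (d + 12) ^ 3 ≤ 4 * ε * (7 * d) ^ 3 := by
          gcongr
          linarith
      _ ≤ 288 := by linarith
  filter_upwards [h.eventually_mul_prod_mul_norm_sq_le hW hA hε hd hdε₁ hx hx₀ hxe hx₀e,
    eventually_add_smul_ne_zero e hx] with t ht hy
  have hangle := one_div_seven_le_pi_sub_two_mul_angle_gen hW (by linarith) hd hy hx₀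
  have hprod := le_prod_pi_sub_angle_gen hW hε (by linarith) (by omega) hcube hy hx₀
  have hangle₀ := (pi_sub_angle_div_pi_mem_Icc (x + t • e) x₀).1
  calc (π - angle (x + t • e) x₀) / π * ‖e‖ ^ 2
      = 7 * d ^ 12 * (1 / 7 * ((π - angle (x + t • e) x₀) / π * (1 / d ^ 12) * ‖e‖ ^ 2)) := by
        field_simp
    _ ≤ 7 * d ^ 12 * ((π - 2 * angle (gen W d (x + t • e)) (gen W d x₀)) / π *
          ((∏ i ∈ Finset.range d, (π - angle (gen W i (x + t • e)) (gen W i x₀)) / π) *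
            ‖e‖ ^ 2)) := by gcongr
    _ ≤ 7 * d ^ 12 * (36 * (d ^ 2 * ε) * (‖x₀‖ * ‖e‖)) := by gcongr
    _ = 252 * (d ^ 14 * ε) * (‖x₀‖ * ‖e‖) := by ring

theorem IsStationary.pi_sub_angle_mul_sin_angle_le
    (h : IsStationary (risk (gen W d) A x₀) x) (hW : ∀ i < d, WDC (W i) ε)
    (hA : RRCP (gen W d) A ε) (hε : 0 ≤ ε) (hd : 2 ≤ d) (hdε : 10 ^ 4 * d ^ 3 * ε ≤ 1)
    (hx : x ≠ 0) (hx₀ : x₀ ≠ 0) :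
    (π - angle x x₀) / π * sin (angle x x₀) ≤ 252 * (d ^ 14 * ε) := by
  obtain ⟨e, hxe, hx₀e, he⟩ := exists_inner_eq_zero_and_norm_eq_norm_mul_sin_angle hx x₀
  have hlim : Tendsto (fun t : ℝ => (π - angle (x + t • e) x₀) / π * ‖e‖ ^ 2) (𝓝[>] 0)
      (𝓝 ((π - angle x x₀) / π * ‖e‖ ^ 2)) :=
    ((tendsto_const_nhds.sub (tendsto_angle_add_smul e hx hx₀)).div_const π).mul_const _
  have hle := le_of_tendsto hlim
    (h.eventually_pi_sub_angle_mul_norm_sq_le hW hA hε hd hdε hx hx₀ hxe hx₀e)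
  rcases (sin_angle_nonneg x x₀).eq_or_lt with hsin | hsin
  · rw [← hsin, mul_zero]
    positivity
  · have hpos : 0 < ‖x₀‖ ^ 2 * sin (angle x x₀) :=
      mul_pos (pow_pos (norm_pos_iff.2 hx₀) 2) hsin
    rw [he] at hle
    refine le_of_mul_le_mul_right ?_ hpos
    linarith

theorem IsStationary.sin_angle_le_of_le_pi_div_two
    (h : IsStationary (risk (gen W d) A x₀) x) (hW : ∀ i < d, WDC (W i) ε)
    (hA : RRCP (gen W d) A ε) (hε : 0 ≤ ε) (hd : 2 ≤ d) (hdε : 10 ^ 4 * d ^ 3 * ε ≤ 1)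
    (hx : x ≠ 0) (hx₀ : x₀ ≠ 0) (hθ : angle x x₀ ≤ π / 2) :
    sin (angle x x₀) ≤ 504 * (d ^ 14 * ε) := by
  have hmain := h.pi_sub_angle_mul_sin_angle_le hW hA hε hd hdε hx hx₀
  have hhalf : 1 / 2 ≤ (π - angle x x₀) / π := by
    rw [le_div_iff₀ pi_pos]
    linarith
  linarith [mul_le_mul_of_nonneg_right hhalf (sin_angle_nonneg x x₀)]

theorem IsStationary.sin_angle_le (h : IsStationary (risk (gen W d) A x₀) x)
    (hW : ∀ i < d, WDC (W i) ε) (hA : RRCP (gen W d) A ε) (hε : 0 ≤ ε) (hd : 2 ≤ d)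
    (hdε : 10 ^ 4 * d ^ 3 * ε ≤ 1) (hx : x ≠ 0) (hx₀ : x₀ ≠ 0) :
    sin (angle x x₀) ≤ 30 * (d ^ 7 * √ε) := by
  have hmain := h.pi_sub_angle_mul_sin_angle_le hW hA hε hd hdε hx hx₀
  have hsin : sin (angle x x₀) ≤ π - angle x x₀ := by
    rw [← sin_pi_sub]
    exact sin_le (sub_nonneg.2 (angle_le_pi x x₀))
  refine (abs_le_of_sq_le_sq' ?_ (by positivity)).2
  calc sin (angle x x₀) ^ 2 ≤ (π - angle x x₀) * sin (angle x x₀) := by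
        rw [sq]
        exact mul_le_mul_of_nonneg_right hsin (sin_angle_nonneg x x₀)
    _ = π * ((π - angle x x₀) / π * sin (angle x x₀)) := by field_simp
    _ ≤ π * (252 * (d ^ 14 * ε)) := by gcongr
    _ ≤ 900 * (d ^ 14 * ε) := by nlinarith [pi_lt_d2, show 0 ≤ d ^ 14 * ε by positivity]
    _ = (30 * (d ^ 7 * √ε)) ^ 2 := by
        rw [mul_pow, mul_pow, sq_sqrt hε]
        ring

theorem abs_phaseFactor_angle_gen_sub_le (hW : ∀ i < d, WDC (W i) ε) (hε : ε < 1 / 2)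
    {y z : E (n 0)} (hy : y ≠ 0) (hz : z ≠ 0) {ψ : ℝ} (hψ : ψ ∈ Icc 0 π) :
    |phaseFactor (angle (gen W d y) (gen W d z)) - phaseFactor (g^[d] ψ)| ≤
      |cos (angle y z) - cos ψ| + d * (4 * ε) :=
  (abs_phaseFactor_sub_le (angle_mem_Icc _ _) (iterate_g_mem_Icc hψ d)).trans
    (abs_cos_sub_cos_iterate_le (θ := fun i => angle (gen W i y) (gen W i z))
      (fun _ => angle_mem_Icc _ _) (abs_cos_angle_gen_succ_sub_le hW hε hy hz) hψ d le_rfl)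

theorem IsStationary.norm_sub_smul_le_of_abs_cos_sub_le
    (h : IsStationary (risk (gen W d) A x₀) x) (hW : ∀ i < d, WDC (W i) ε)
    (hA : RRCP (gen W d) A ε) (hε : 0 ≤ ε) (hd : 1 ≤ d) (hdε : 100 * (d * ε) ≤ 1)
    (hx : x ≠ 0) (hx₀ : x₀ ≠ 0) {ψ : ℝ} (hψ : ψ ∈ Icc 0 π) (hψ₁ : cos ψ ^ 2 = 1)
    (hθ : |cos (angle x x₀) - cos ψ| ≤ sin (angle x x₀)) :
    ‖x - (phaseFactor (g^[d] ψ) * cos ψ) • x₀‖ ≤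
      (80 * (d * ε) + 5 * sin (angle x x₀)) * ‖x₀‖ := by
  have hεd : ε ≤ d * ε := le_mul_of_one_le_left hε (by exact_mod_cast hd)
  have hnorm := h.abs_norm_sub_phaseFactor_mul_norm_le hW hA hε hd hdε hx hx₀
  have hphase := abs_phaseFactor_angle_gen_sub_le hW (by linarith) hx hx₀ hψ
  have hF₀ : 0 ≤ phaseFactor (g^[d] ψ) :=
    le_trans (by positivity) (two_div_pi_le_phaseFactor (iterate_g_mem_Icc hψ d))
  have hF₂ := phaseFactor_le_two (iterate_g_mem_Icc hψ d)
  set F := phaseFactor (g^[d] ψ)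
  set θ := angle x x₀
  have hcosψ : |cos ψ| = 1 := by rwa [← sq_eq_sq₀ (abs_nonneg _) zero_le_one, sq_abs, one_pow]
  have hFcos : |F * cos ψ| ≤ 2 := by rwa [abs_mul, hcosψ, mul_one, abs_of_nonneg hF₀]
  have hradial : |‖x‖ - F * cos ψ * (‖x₀‖ * cos θ)| ≤
      76 * (d * ε) * ‖x₀‖ + (sin θ + d * (4 * ε)) * ‖x₀‖ + 2 * sin θ * ‖x₀‖ := by
    calc |‖x‖ - F * cos ψ * (‖x₀‖ * cos θ)|
        = |(‖x‖ - phaseFactor (angle (gen W d x) (gen W d x₀)) * ‖x₀‖) +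
            (phaseFactor (angle (gen W d x) (gen W d x₀)) - F) * ‖x₀‖ -
            F * cos ψ * (cos θ - cos ψ) * ‖x₀‖| := by
          congr 1
          linear_combination (-(F * ‖x₀‖)) * hψ₁
      _ ≤ _ := by
          refine (abs_sub _ _).trans (add_le_add ((abs_add_le _ _).trans ?_) ?_)
          · rw [abs_mul, abs_norm]
            gcongr
            exact hphase.trans (by gcongr)
          · rw [abs_mul, abs_mul, abs_norm]
            gcongr
  have hcross : |F * cos ψ| * (‖x₀‖ * sin θ) ≤ 2 * (‖x₀‖ * sin θ) :=
    mul_le_mul_of_nonneg_right hFcos (mul_nonneg (norm_nonneg _) (sin_angle_nonneg x x₀))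
  linarith [norm_sub_smul_le x x₀ (F * cos ψ)]

end Stationary

theorem abs_cos_sub_one_le_sin {θ : ℝ} (hθ : θ ∈ Icc 0 (π / 2)) : |cos θ - 1| ≤ sin θ := by
  have hcos := cos_nonneg_of_neg_pi_div_two_le_of_le (by linarith [hθ.1, pi_pos]) hθ.2
  have hsin := sin_nonneg_of_nonneg_of_le_pi hθ.1 (by linarith [hθ.2, pi_pos])
  rw [abs_of_nonpos (sub_nonpos.2 (cos_le_one θ))]
  nlinarith [sin_sq_add_cos_sq θ, mul_nonneg hsin hcos]

theorem abs_cos_add_one_le_sin {θ : ℝ} (hθ : θ ∈ Icc (π / 2) π) : |cos θ + 1| ≤ sin θ := by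
  have h := abs_cos_sub_one_le_sin (θ := π - θ) ⟨sub_nonneg.2 hθ.2, by linarith [hθ.1]⟩
  rwa [cos_pi_sub, sin_pi_sub, ← neg_add', abs_neg] at h

section Stationary

variable {n : ℕ → ℕ} {m d : ℕ} {W : ∀ i, Matrix (Fin (n (i + 1))) (Fin (n i)) ℝ}
  {A : Matrix (Fin m) (Fin (n d)) ℝ} {ε : ℝ} {x x₀ : E (n 0)}

theorem IsStationary.mem_closedBall_of_angle_le (h : IsStationary (risk (gen W d) A x₀) x)
    (hW : ∀ i < d, WDC (W i) ε) (hA : RRCP (gen W d) A ε) (hε : 0 ≤ ε) (hd : 2 ≤ d)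
    (hdε : 10 ^ 4 * d ^ 3 * ε ≤ 1) (hx : x ≠ 0) (hx₀ : x₀ ≠ 0) (hθ : angle x x₀ ≤ π / 2) :
    x ∈ Metric.closedBall x₀ (10 ^ 4 * (d ^ 14 * ε) * ‖x₀‖) := by
  have hd₁ : (1 : ℝ) ≤ d := by exact_mod_cast (by omega : 1 ≤ d)
  have hdist := h.norm_sub_smul_le_of_abs_cos_sub_le hW hA hε (by omega)
    (hundred_mul_le_one_of_pow_three hε hd hdε) hx hx₀ zero_mem_Icc_pi
    (by rw [cos_zero, one_pow])
    (by rw [cos_zero]; exact abs_cos_sub_one_le_sin ⟨angle_nonneg x x₀, hθ⟩)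
  rw [Function.iterate_fixed g_zero, phaseFactor_zero, cos_zero, one_mul, one_smul] at hdist
  have hsin := h.sin_angle_le_of_le_pi_div_two hW hA hε hd hdε hx hx₀ hθ
  have hdd : d * ε ≤ d ^ 14 * ε := by
    gcongr
    exact le_self_pow₀ hd₁ (by norm_num)
  rw [mem_closedBall_iff_norm]
  refine hdist.trans ?_
  gcongr
  linarith [show 0 ≤ d * ε by positivity]

theorem IsStationary.mem_closedBall_of_le_angle (h : IsStationary (risk (gen W d) A x₀) x)
    (hW : ∀ i < d, WDC (W i) ε) (hA : RRCP (gen W d) A ε) (hε : 0 ≤ ε) (hd : 2 ≤ d)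
    (hdε : 10 ^ 4 * d ^ 3 * ε ≤ 1) (hx : x ≠ 0) (hx₀ : x₀ ≠ 0) (hθ : π / 2 ≤ angle x x₀) :
    x ∈ Metric.closedBall (-(rho d • x₀)) (10 ^ 4 * (d ^ 7 * √ε) * ‖x₀‖) := by
  have hd₁ : (1 : ℝ) ≤ d := by exact_mod_cast (by omega : 1 ≤ d)
  have hdε₁ := hundred_mul_le_one_of_pow_three hε hd hdε
  have hdist := h.norm_sub_smul_le_of_abs_cos_sub_le hW hA hε (by omega) hdε₁ hx hx₀
    pi_mem_Icc_pi (by rw [cos_pi, neg_one_sq])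
    (by rw [cos_pi, sub_neg_eq_add]; exact abs_cos_add_one_le_sin ⟨hθ, angle_le_pi x x₀⟩)
  rw [← breve, ← rho_eq_phaseFactor (by omega), cos_pi, mul_neg_one, neg_smul] at hdist
  have hsin := h.sin_angle_le hW hA hε hd hdε hx hx₀
  have hε₁ : ε ≤ 1 := by linarith [le_mul_of_one_le_left hε hd₁]
  have hdd : d * ε ≤ d ^ 7 * √ε := by
    gcongr
    · exact le_self_pow₀ hd₁ (by norm_num)
    · exact le_sqrt_of_sq_le ((sq ε).trans_le (mul_le_of_le_one_left hε hε₁))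
  rw [mem_closedBall_iff_norm]
  refine hdist.trans ?_
  gcongr
  linarith [show 0 ≤ d * ε by positivity]

theorem exists_hasOneSidedDeriv_risk_neg (hW : ∀ i < d, WDC (W i) ε) (hA : RRCP (gen W d) A ε)
    (hε : 0 ≤ ε) (hd : 2 ≤ d) (hdε : 10 ^ 4 * d ^ 3 * ε ≤ 1) (hx : x ≠ 0) (hx₀ : x₀ ≠ 0)
    (hnear : x ∉ Metric.closedBall x₀ (10 ^ 4 * (d ^ 14 * ε) * ‖x₀‖))
    (hnear_neg : x ∉ Metric.closedBall (-(rho d • x₀)) (10 ^ 4 * (d ^ 7 * √ε) * ‖x₀‖)) :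
    ∃ v, ∃ D < 0, HasOneSidedDeriv (risk (gen W d) A x₀) x v D := by
  by_contra! hnone
  have hstat : IsStationary (risk (gen W d) A x₀) x := fun v D hD =>
    le_of_not_gt fun hneg => hnone v D hneg hD
  rcases le_total (angle x x₀) (π / 2) with hθ | hθ
  · exact hnear (hstat.mem_closedBall_of_angle_le hW hA hε hd hdε hx hx₀ hθ)
  · exact hnear_neg (hstat.mem_closedBall_of_le_angle hW hA hε hd hdε hx hx₀ hθ)

end Stationary

section Radii

variable {d : ℕ} {ε : ℝ}

theorem rpow_one_div_four_pow_four (hε : 0 ≤ ε) : (ε ^ (1 / 4 : ℝ)) ^ 4 = ε := by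
  simpa only [one_div, Nat.cast_ofNat] using rpow_inv_natCast_pow hε four_ne_zero

theorem sqrt_eq_rpow_one_div_four_sq (hε : 0 ≤ ε) : √ε = (ε ^ (1 / 4 : ℝ)) ^ 2 := by
  rw [sqrt_eq_iff_eq_sq hε (by positivity), ← pow_mul, rpow_one_div_four_pow_four hε]

theorem rpow_one_div_four_lt_one (hε : 0 ≤ ε) (hd : 1 ≤ d) (hdε : d ^ 8 * ε ^ (1 / 4 : ℝ) < 1) :
    ε ^ (1 / 4 : ℝ) < 1 :=
  (le_mul_of_one_le_left (by positivity) (one_le_pow₀ (by exact_mod_cast hd))).trans_lt hdε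

theorem pow_three_mul_le_rpow (hε : 0 ≤ ε) (hd : 1 ≤ d) (hdε : d ^ 8 * ε ^ (1 / 4 : ℝ) < 1) :
    d ^ 3 * ε ≤ d ^ 8 * ε ^ (1 / 4 : ℝ) := by
  have hd₁ : (1 : ℝ) ≤ d := by exact_mod_cast hd
  calc d ^ 3 * ε = d ^ 3 * (ε ^ (1 / 4 : ℝ)) ^ 4 := by rw [rpow_one_div_four_pow_four hε]
    _ ≤ d ^ 8 * ε ^ (1 / 4 : ℝ) := by
      gcongr
      · norm_num
      · exact pow_le_of_le_one (by positivity) (rpow_one_div_four_lt_one hε hd hdε).le four_ne_zero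

theorem pow_fourteen_mul_lt_rpow (hε : 0 < ε) (hd : 1 ≤ d)
    (hdε : d ^ 8 * ε ^ (1 / 4 : ℝ) < 1) : d ^ 14 * ε < d ^ 3 * ε ^ (1 / 4 : ℝ) := by
  have hd₁ : (1 : ℝ) ≤ d := by exact_mod_cast hd
  calc d ^ 14 * ε = d ^ 11 * (ε ^ (1 / 4 : ℝ)) ^ 3 * (d ^ 3 * ε ^ (1 / 4 : ℝ)) := by
        nth_rw 1 [← rpow_one_div_four_pow_four hε.le]
        ring
    _ ≤ (d ^ 8) ^ 3 * (ε ^ (1 / 4 : ℝ)) ^ 3 * (d ^ 3 * ε ^ (1 / 4 : ℝ)) := by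
        rw [← pow_mul]
        gcongr
        norm_num
    _ < d ^ 3 * ε ^ (1 / 4 : ℝ) := by
        rw [← mul_pow]
        exact mul_lt_of_lt_one_left (by positivity)
          (pow_lt_one₀ (by positivity) hdε three_ne_zero)

theorem pow_seven_mul_sqrt_lt_rpow (hε : 0 < ε) (hd : 1 ≤ d)
    (hdε : d ^ 8 * ε ^ (1 / 4 : ℝ) < 1) : d ^ 7 * √ε < d ^ 14 * ε ^ (1 / 4 : ℝ) := by
  have hd₁ : (1 : ℝ) ≤ d := by exact_mod_cast hd
  calc d ^ 7 * √ε = d ^ 7 * ε ^ (1 / 4 : ℝ) * ε ^ (1 / 4 : ℝ) := by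
        rw [sqrt_eq_rpow_one_div_four_sq hε.le]
        ring
    _ < d ^ 7 * ε ^ (1 / 4 : ℝ) :=
        mul_lt_of_lt_one_right (by positivity) (rpow_one_div_four_lt_one hε.le hd hdε)
    _ ≤ d ^ 14 * ε ^ (1 / 4 : ℝ) := by
        gcongr
        norm_num

theorem closedBall_union_closedBall_subset {V : Type*} [NormedAddCommGroup V] {x₀ : V}
    (hx₀ : x₀ ≠ 0) (z : V) (hε : 0 < ε) (hd : 1 ≤ d) (hdε : d ^ 8 * ε ^ (1 / 4 : ℝ) < 1) :
    Metric.closedBall x₀ (10 ^ 4 * (d ^ 14 * ε) * ‖x₀‖) ∪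
        Metric.closedBall z (10 ^ 4 * (d ^ 7 * √ε) * ‖x₀‖) ⊆
      Metric.ball x₀ (10 ^ 4 * d ^ 3 * ε ^ (1 / 4 : ℝ) * ‖x₀‖) ∪
        Metric.ball z (10 ^ 4 * d ^ 14 * ε ^ (1 / 4 : ℝ) * ‖x₀‖) := by
  have hnorm := norm_pos_iff.2 hx₀
  have hradius := pow_fourteen_mul_lt_rpow hε hd hdε
  have hradius_neg := pow_seven_mul_sqrt_lt_rpow hε hd hdε
  exact union_subset_union
    (Metric.closedBall_subset_ball (mul_lt_mul_of_pos_right (by linarith) hnorm))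
    (Metric.closedBall_subset_ball (mul_lt_mul_of_pos_right (by linarith) hnorm))

end Radii

end DeepPR

end

theorem theorem3_general (d : ℕ) (n : ℕ → ℕ) (m : ℕ)
    (W : ∀ i : ℕ, Matrix (Fin (n (i + 1))) (Fin (n i)) ℝ) (A : Matrix (Fin m) (Fin (n d)) ℝ)
    (ε : ℝ) (hd : 2 ≤ d) (hdε : 10 ^ 4 * (d : ℝ) ^ 3 * ε ≤ 1)
    (hW : ∀ i : ℕ, i < d → DeepPR.WDC (W i) ε) (hA : DeepPR.RRCP (DeepPR.gen W d) A ε)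
    (x₀ : DeepPR.E (n 0)) (hx₀ : x₀ ≠ 0) :
    (∀ x : DeepPR.E (n 0), x ≠ 0 →
      x ∉ Metric.closedBall x₀ (10 ^ 4 * ((d : ℝ) ^ 14 * ε) * ‖x₀‖) ∪
          Metric.closedBall (-(DeepPR.rho d • x₀)) (10 ^ 4 * ((d : ℝ) ^ 7 * √ε) * ‖x₀‖) →
      ∃ v : DeepPR.E (n 0), ∃ D : ℝ, D < 0 ∧
        DeepPR.HasOneSidedDeriv (DeepPR.risk (DeepPR.gen W d) A x₀) x (-v) D) ∧
    (∀ x : DeepPR.E (n 0), x ≠ 0 → ∃ D : ℝ, D < 0 ∧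
      DeepPR.HasOneSidedDeriv (DeepPR.risk (DeepPR.gen W d) A x₀) 0 x D) := by
  have hε : 0 ≤ ε := (hW 0 (by omega)).nonneg hx₀
  have hε_small : 200 * ε ≤ 1 := by
    have hd₂ : (2 : ℝ) ≤ d := by exact_mod_cast hd
    linarith [DeepPR.hundred_mul_le_one_of_pow_three hε hd hdε, mul_le_mul_of_nonneg_right hd₂ hε]
  have hgen {x : DeepPR.E (n 0)} (hx : x ≠ 0) : DeepPR.gen W d x ≠ 0 :=
    DeepPR.gen_ne_zero hW (by linarith) hx d le_rfl
  refine ⟨fun x hx hfar => ?_, fun x hx => ?_⟩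
  · rw [Set.mem_union, not_or] at hfar
    obtain ⟨v, hv⟩ :=
      DeepPR.exists_hasOneSidedDeriv_risk_neg hW hA hε hd hdε hx hx₀ hfar.1 hfar.2
    exact ⟨-v, by rwa [neg_neg]⟩
  · have hpi : 1 / 2 < 2 / Real.pi := by
      rw [div_lt_div_iff₀ two_pos Real.pi_pos]
      linarith [Real.pi_lt_four]
    exact DeepPR.exists_hasOneSidedDeriv_risk_zero_neg hA (by linarith) (hgen hx) (hgen hx₀)

theorem theorem3 :
    (∀ d : ℕ, 2 ≤ d → 0 < DeepPR.rho d) ∧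
    Filter.Tendsto DeepPR.rho Filter.atTop (nhds 1) ∧
    ∃ K₁ K₂ : ℝ, 0 < K₁ ∧ 0 < K₂ ∧
      ∀ (d : ℕ) (n : ℕ → ℕ) (m : ℕ)
        (W : ∀ i : ℕ, Matrix (Fin (n (i + 1))) (Fin (n i)) ℝ)
        (A : Matrix (Fin m) (Fin (n d)) ℝ) (ε : ℝ),
        2 ≤ d → 0 < ε → K₁ * (d : ℝ) ^ 8 * ε ^ (1 / 4 : ℝ) ≤ 1 →
        (∀ i : ℕ, i < d → DeepPR.WDC (W i) ε) →
        DeepPR.RRCP (DeepPR.gen W d) A ε →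
        ∀ x₀ : DeepPR.E (n 0), x₀ ≠ 0 →
          (∀ x : DeepPR.E (n 0), x ≠ 0 →
            x ∉ Metric.ball x₀ (K₂ * (d : ℝ) ^ 3 * ε ^ (1 / 4 : ℝ) * ‖x₀‖) ∪
                Metric.ball (-(DeepPR.rho d • x₀)) (K₂ * (d : ℝ) ^ 14 * ε ^ (1 / 4 : ℝ) * ‖x₀‖) →
            ∃ v : DeepPR.E (n 0), ∃ D : ℝ, D < 0 ∧
              DeepPR.HasOneSidedDeriv (DeepPR.risk (DeepPR.gen W d) A x₀) x (-v) D) ∧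
          (∀ x : DeepPR.E (n 0), x ≠ 0 → ∃ D : ℝ, D < 0 ∧
            DeepPR.HasOneSidedDeriv (DeepPR.risk (DeepPR.gen W d) A x₀) 0 x D) := by
  refine ⟨fun d hd => DeepPR.rho_pos (by omega), DeepPR.tendsto_rho, 10 ^ 4, 10 ^ 4, by norm_num,
    by norm_num, fun d n m W A ε hd hε hdε hW hA x₀ hx₀ => ?_⟩
  have hd₁ : 1 ≤ d := by omega
  have hdε₁ : (d : ℝ) ^ 8 * ε ^ (1 / 4 : ℝ) < 1 := by linarith
  have hradius := DeepPR.pow_three_mul_le_rpow hε.le hd₁ hdε₁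
  obtain ⟨hdescent, hzero⟩ :=
    theorem3_general d n m W A ε hd (by linarith) hW hA x₀ hx₀
  exact ⟨fun x hx hfar => hdescent x hx fun hnear =>
    hfar (DeepPR.closedBall_union_closedBall_subset hx₀ _ hε hd₁ hdε₁ hnear), hzero⟩
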